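/- Let $(\Omega,\rho)$ be a metric space with $\operatorname{diam}(\Omega)\le 1$ that is doubling: for some finite $D$, every closed ball of radius $r$ is covered by $D$ closed balls of radius $r/2$. Let $D^*$ be the least such $D$ and $\operatorname{ddim}=\log_2 D^*$. Let $\mu$ be a Borel probability measure on $\Omega$. For $A\subseteq\Omega$, a real function $f$ and a measure $\nu$ carried by $A$, put $$\Lambda_f(x,A)=\sup_{x'\in A\setminus\{x\}}\frac{|f(x)-f(x')|}{\rho(x,x')},\qquad \overline\Lambda_f(\nu,A)=\int_A\Lambda_f(x,A)\,d\nu(x),\qquad \widetilde\Lambda_f(\nu,A)=\sup_{t>0}t\,\nu\{x\in A:\Lambda_f(x,A)\ge t\}$$ (with $\sup\emptyset=0$). Given a finite nonempty $A\subseteq\Omega$ and $y:A\to\mathbb R$, put $$R_x(u,v)=\frac{y(v)-y(u)}{\rho(x,v)+\rho(x,u)},\qquad F_x(u,v)=y(u)+R_x(u,v)\,\rho(x,u)\qquad(x\in\Omega,\ u,v\in A),$$ where $R_x(x,x)=0$. The pointwise minimum slope extension (PMSE) of $y$ from $A$ to $\Omega$ is the function $f:\Omega\to\mathbb R$ whose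 value at $x$ is the common limit, as $\varepsilon\to0^+$, of the supremum and of the infimum of $F_x(u,v)$ over the pairs $(u,v)\in A^2$ with $R_x(u,v)>\sup_{A^2}R_x-\varepsilon$. Let $n\ge1$, let $X_1,\dots,X_n$ be drawn independently from $\mu$, let $\Omega_n=\{X_1,\dots,X_n\}$, and let $\mu_n=\frac1n\sum_{i=1}^n\delta_{X_i}$ be the empirical measure. There are absolute constants $C,c_1,c_2,c_3$ and a single program, neither of which depends on $\Omega,\rho,\mu,n$, such that the following hold. 1. For every sample and every $y:\Omega_n\to\{0,1\}$ with $\widetilde\Lambda_y(\mu_n,\Omega_n)\le n$, the PMSE $f$ of $y$ from $\Omega_n$ to $\Omega$ is well defined, takes values in $[0,1]$ and coincides with $y$ on $\Omega_n$. For every $x\in\Omega$, the program, given $n$, the labels $y(X_i)$ and the distances $\rho(x,X_i)$, outputs $f(x)$ after at most $C n^2$ unit-cost steps (exact real arithmetic, comparisons of reals, and index-controlled loops). 2. With probability at least $$1-2^{c_3\operatorname{ddim}}\,\frac{\log^3 n}{n}$$ over the sample, simultaneously for all $y:\Omega_n\to\{0,1\}$ with $\widetilde\Lambda_y(\mu_n,\Omega_n)\le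 n$, the PMSE $f$ of $y$ satisfies $$\widetilde\Lambda_f(\mu,\Omega)\le\overline\Lambda_f(\mu,\Omega)\le 2^{c_1\operatorname{ddim}}\log^2(n)\,\overline\Lambda_y(\mu_n,\Omega_n)\le 2^{c_2\operatorname{ddim}}\log^3(n)\,\widetilde\Lambda_y(\mu_n,\Omega_n).$$ -/

import Mathlib

open MeasureTheory Filter Topology Set
open scoped ENNReal

noncomputable section

namespace AvgSlope

/-! ## Doubling dimension -/

/-- Every closed `r`-ball is contained in a union of at most `D` closed `r/2`-balls. -/
def DoublingWith (Ω : Type*) [MetricSpace Ω] (D : ℕ) : Prop :=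
  ∀ (x : Ω) (r : ℝ), 0 < r → ∃ s : Finset Ω, s.card ≤ D ∧
    Metric.closedBall x r ⊆ ⋃ z ∈ s, Metric.closedBall z (r / 2)

/-- The metric space is doubling. -/
def IsDoubling (Ω : Type*) [MetricSpace Ω] : Prop := ∃ D : ℕ, DoublingWith Ω D

/-- The doubling dimension `log₂ D*`, where `D*` is the least doubling constant
(meaningful for doubling spaces). -/
def ddim (Ω : Type*) [MetricSpace Ω] : ℝ :=
  Real.logb 2 ((sInf {D : ℕ | DoublingWith Ω D} : ℕ) : ℝ)

/-! ## Local and average slope -/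

section Slope

variable {Ω : Type*} [MetricSpace Ω]

/-- The slope `Λ_f(x, A) = sup_{x' ∈ A \ {x}} |f x - f x'| / ρ(x, x')`, with values in `[0, ∞]`
(a supremum over the empty set is `0`). -/
def localSlope (f : Ω → ℝ) (x : Ω) (A : Set Ω) : ℝ≥0∞ :=
  ⨆ x' ∈ A \ {x}, ENNReal.ofReal (|f x - f x'| / dist x x')

variable [MeasurableSpace Ω]

/-- The strong average slope of `f` on the subspace `A` carrying the measure `ν`. -/
def strongSlope (f : Ω → ℝ) (ν : Measure Ω) (A : Set Ω) : ℝ≥0∞ :=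
  ∫⁻ x in A, localSlope f x A ∂ν

/-- The weak average slope `sup_{t > 0} t ν {x ∈ A | Λ_f(x, A) ≥ t}` of `f` on the subspace `A`
carrying the measure `ν`. -/
def weakSlope (f : Ω → ℝ) (ν : Measure Ω) (A : Set Ω) : ℝ≥0∞ :=
  ⨆ (t : ℝ) (_ : 0 < t), ENNReal.ofReal t * ν {x ∈ A | ENNReal.ofReal t ≤ localSlope f x A}

/-- The empirical measure `n⁻¹ ∑ᵢ δ_{Xᵢ}` of a sample; it lives on the set `range X`. -/
def empiricalMeasure {n : ℕ} (X : Fin n → Ω) : Measure Ω :=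
  (n : ℝ≥0∞)⁻¹ • ∑ i, Measure.dirac (X i)

end Slope

/-! ## Pointwise minimum slope extension -/

section PMSE

variable {Ω : Type*} [MetricSpace Ω]

/-- `R_x(u, v)`; the only case of a zero denominator is `u = v = x`, where the value is `0`. -/
def pairSlope (f : Ω → ℝ) (x u v : Ω) : ℝ := (f v - f u) / (dist x v + dist x u)

/-- `F_x(u, v) = f(u) + R_x(u, v) ρ(x, u)`. -/
def pairValue (f : Ω → ℝ) (x u v : Ω) : ℝ := f u + pairSlope f x u v * dist x u

/-- `R*_x`, the supremum of `R_x` over `A × A`. -/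
def maxPairSlope (f : Ω → ℝ) (A : Set Ω) (x : Ω) : ℝ :=
  sSup {r : ℝ | ∃ u ∈ A, ∃ v ∈ A, r = pairSlope f x u v}

/-- `Φ_x(ε)`, the values `F_x(u, v)` over the pairs that are `ε`-close to maximizing `R_x`. -/
def nearMaxValues (f : Ω → ℝ) (A : Set Ω) (x : Ω) (ε : ℝ) : Set ℝ :=
  {w : ℝ | ∃ u ∈ A, ∃ v ∈ A, maxPairSlope f A x - ε < pairSlope f x u v ∧ w = pairValue f x u v}

/-- `g` is the pointwise minimum slope extension of `f` from `A`:
`g x = lim_{ε → 0+} sup Φ_x(ε) = lim_{ε → 0+} inf Φ_x(ε)` at every `x`. If `A = {a}`, or if `f` is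
constant on `A`, this says that `g` is that constant. -/
def IsPMSE (f : Ω → ℝ) (A : Set Ω) (g : Ω → ℝ) : Prop :=
  ∀ x, Tendsto (fun ε => sSup (nearMaxValues f A x ε)) (𝓝[>] 0) (𝓝 (g x)) ∧
    Tendsto (fun ε => sInf (nearMaxValues f A x ε)) (𝓝[>] 0) (𝓝 (g x))

/-- The pointwise minimum slope extension of `f` from `A` to the whole space. -/
def pmse (f : Ω → ℝ) (A : Set Ω) (x : Ω) : ℝ :=
  limUnder (𝓝[>] (0 : ℝ)) (fun ε => sSup (nearMaxValues f A x ε))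

end PMSE

/-! ## A unit-cost machine over the reals -/

/-- The memory: registers holding natural numbers, and arrays of real cells. -/
structure Store where
  /-- the index registers -/
  idx : ℕ → ℕ
  /-- `cell a m` is the `m`-th cell of array `a` -/
  cell : ℕ → ℕ → ℝ

/-- `(a, i)` addresses the cell of array `a` whose position is the content of index register `i`. -/
abbrev Addr := ℕ × ℕ

/-- The value stored at an address. -/
def Store.get (s : Store) (a : Addr) : ℝ := s.cell a.1 (s.idx a.2)

/-- Write a real number at an address. -/
def Store.set (s : Store) (a : Addr) (v : ℝ) : Store where
  idx := s.idx
  cell := fun b m => if b = a.1 ∧ m = s.idx a.2 then v else s.cell b m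

/-- Write a natural number into an index register. -/
def Store.setIdx (s : Store) (i k : ℕ) : Store where
  idx := fun j => if j = i then k else s.idx j
  cell := s.cell

/-- The arithmetic operations on real cells. -/
inductive ArithOp
  | add
  | sub
  | mul
  | div

/-- The result of an arithmetic operation. -/
def ArithOp.eval : ArithOp → ℝ → ℝ → ℝ
  | .add, x, y => x + y
  | .sub, x, y => x - y
  | .mul, x, y => x * y
  | .div, x, y => x / y

/-- Programs: loading a rational constant, one arithmetic operation, setting an index register to
a numeral, composition, branching on a comparison of two real cells, and loops in which index
register `i` runs through `0, …, N - 1`, `N` being the content of register `j` on entry. -/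
inductive Prog
  | skip
  | const (a : Addr) (q : ℚ)
  | arith (o : ArithOp) (a b c : Addr)
  | setIdx (i k : ℕ)
  | seq (p q : Prog)
  | ifLt (a b : Addr) (p q : Prog)
  | loop (i j : ℕ) (p : Prog)

/-- The store after running a program, with the number of elementary steps: each assignment,
comparison, loop entry and loop iteration costs one unit. -/
def Prog.run : Prog → Store → Store × ℕ
  | .skip, s => (s, 1)
  | .const a q, s => (s.set a q, 1)
  | .arith o a b c, s => (s.set a (o.eval (s.get b) (s.get c)), 1)
  | .setIdx i k, s => (s.setIdx i k, 1)
  | .seq p q, s => ((q.run (p.run s).1).1, (p.run s).2 + (q.run (p.run s).1).2)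
  | .ifLt a b p q, s =>
      open Classical in
      if s.get a < s.get b then ((p.run s).1, (p.run s).2 + 1)
      else ((q.run s).1, (q.run s).2 + 1)
  | .loop i j p, s =>
      (List.range (s.idx j)).foldl
        (fun acc k => ((p.run (acc.1.setIdx i k)).1, acc.2 + 1 + (p.run (acc.1.setIdx i k)).2))
        (s, 1)

/-- The initial store for `n` labelled points: register `0` holds `n`, array `0` the distances
from the query point to the sample points, array `1` the labels; everything else is `0`. -/
def inputStore {n : ℕ} (distances labels : Fin n → ℝ) : Store where
  idx := fun j => if j = 0 then n else 0
  cell := fun a m =>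
    if h : m < n then
      if a = 0 then distances ⟨m, h⟩ else if a = 1 then labels ⟨m, h⟩ else 0
    else 0

/-- The output of a program is read from the first cell of array `2`. -/
def Prog.output (P : Prog) (s : Store) : ℝ := (P.run s).1.cell 2 0

/-- The number of steps of a program. -/
def Prog.time (P : Prog) (s : Store) : ℕ := (P.run s).2

end AvgSlope

end

/-! Write `R` for the maximal pair slope at `x`. The lower cones `y v - R ρ(x, v)` and the upper
cones `y u + R ρ(x, u)` touch at the height `pmse y A x`, which bounds the slope of the extension at
`x` by `R` (`abs_pmse_sub_le`). For nonconstant 0-1 labels `R = 1 / S`, where `S` is the sum of the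
distances from `x` to the two label classes. A sample point nearest to `x` is within `S` of a point
of the opposite label, so its label slope is at least `R` (`slope_le_nearest`).

To integrate, take nets at the scales `2^-k`, `k ≤ K + 1`, with `2^K ≥ n²`. With high probability
every net ball satisfies `n μ(B) ≤ 2 #B + b`, where `#B` counts sample indices and `b` is
logarithmic in `n` (`exists_uniform_event`). If `x` is farther than `2^-K` from the sample, a net
ball of comparable radius contains `x` but no sample point; its mass is at most `b / n` and is
charged to the nearest sample point. Otherwise use a ball of radius `2^-K`: label slopes are at most
`n²`, so `S ≥ 2^-K`, and every sample point in the ball has label slope at least `R / 4`.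

Doubling bounds the overlap of the enlarged balls, so each scale costs `O(b)` times the average
label slope, up to a power of the doubling constant. Logarithmically many scales give `log² n`; the
last logarithm is the harmonic sum relating weak and strong averages (`strongSlope_le_weakSlope`).
-/

namespace AvgSlope

/-! ### The extension from a finite set: existence and pointwise slope bound. -/

section Extension

variable {Ω : Type*} [MetricSpace Ω]

/-- A zero denominator forces `u = v = x`, so the identity survives division by zero. -/
lemma pairSlope_mul (y : Ω → ℝ) (x u v : Ω) :
    pairSlope y x u v * (dist x v + dist x u) = y v - y u := by
  unfold pairSlope
  by_cases h : dist x v + dist x u = 0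
  · have hv : dist x v = 0 := by linarith [dist_nonneg (x := x) (y := v), dist_nonneg (x := x) (y := u)]
    have hu : dist x u = 0 := by linarith [dist_nonneg (x := x) (y := v), dist_nonneg (x := x) (y := u)]
    rw [← dist_eq_zero.1 hv, ← dist_eq_zero.1 hu]; simp
  · field_simp

lemma le_pairSlope_mul {y : Ω → ℝ} {x u v : Ω} {R : ℝ} (h : pairSlope y x u v ≤ R) :
    y v - R * dist x v ≤ y u + R * dist x u := by
  have h1 := pairSlope_mul y x u v
  have h2 : pairSlope y x u v * (dist x v + dist x u) ≤ R * (dist x v + dist x u) :=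
    mul_le_mul_of_nonneg_right h (by positivity)
  linarith

/-- The pair `(u, v)` of points of `A` maximizes the slope `R_x`. -/
structure IsMaxPair (y : Ω → ℝ) (A : Set Ω) (x u v : Ω) : Prop where
  left_mem : u ∈ A
  right_mem : v ∈ A
  le : ∀ u' ∈ A, ∀ v' ∈ A, pairSlope y x u' v' ≤ pairSlope y x u v

lemma exists_isMaxPair (y : Ω → ℝ) {A : Set Ω} (hA : A.Finite) (hne : A.Nonempty) (x : Ω) :
    ∃ u v, IsMaxPair y A x u v := by
  obtain ⟨p, hp, hmax⟩ := (hA.prod hA).exists_maximalFor (fun p : Ω × Ω => pairSlope y x p.1 p.2)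
    (A ×ˢ A) (hne.prod hne)
  refine ⟨p.1, p.2, hp.1, hp.2, fun u' hu v' hv => ?_⟩
  by_contra hlt
  exact hlt (hmax (j := (u', v')) ⟨hu, hv⟩ (not_le.1 hlt).le)

variable {y : Ω → ℝ} {A : Set Ω} {x u v u' v' : Ω}

namespace IsMaxPair

lemma slope_nonneg (h : IsMaxPair y A x u v) : 0 ≤ pairSlope y x u v := by
  have := h.le u h.left_mem u h.left_mem
  simpa [pairSlope] using this

lemma maxPairSlope_eq (h : IsMaxPair y A x u v) : maxPairSlope y A x = pairSlope y x u v := by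
  refine IsGreatest.csSup_eq ⟨⟨u, h.left_mem, v, h.right_mem, rfl⟩, ?_⟩
  rintro r ⟨u', hu, v', hv, rfl⟩
  exact h.le u' hu v' hv

lemma pairValue_eq (y : Ω → ℝ) (x u v : Ω) :
    pairValue y x u v = y v - pairSlope y x u v * dist x v := by
  have := pairSlope_mul y x u v
  unfold pairValue; linarith

lemma pairValue_le (h : IsMaxPair y A x u v) {w : Ω} (hw : w ∈ A) :
    pairValue y x u v ≤ y w + pairSlope y x u v * dist x w := by
  rw [pairValue_eq]
  exact le_pairSlope_mul (h.le w hw v h.right_mem)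

lemma le_pairValue (h : IsMaxPair y A x u v) {w : Ω} (hw : w ∈ A) :
    y w - pairSlope y x u v * dist x w ≤ pairValue y x u v :=
  le_pairSlope_mul (h.le u h.left_mem w hw)

lemma slope_unique (h : IsMaxPair y A x u v) (h' : IsMaxPair y A x u' v') :
    pairSlope y x u v = pairSlope y x u' v' :=
  le_antisymm (h'.le _ h.left_mem _ h.right_mem) (h.le _ h'.left_mem _ h'.right_mem)

/-- The value is the minimum of the upper cones over `A` and the maximum of the lower ones, so it
depends only on the maximal slope. -/
lemma value_unique (h : IsMaxPair y A x u v) (h' : IsMaxPair y A x u' v') :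
    pairValue y x u v = pairValue y x u' v' := by
  have e := h.slope_unique h'
  refine le_antisymm ?_ ?_
  · have := h.pairValue_le h'.left_mem
    rw [e] at this; exact this
  · have := h'.pairValue_le h.left_mem
    rw [← e] at this; exact this

/-- Finitely many slopes occur; once `ε` is below the gap under the maximum, near-maximal pairs are
maximal. -/
lemma eventually_nearMaxValues (h : IsMaxPair y A x u v) (hA : A.Finite) :
    ∀ᶠ ε in 𝓝[>] (0 : ℝ), nearMaxValues y A x ε = {pairValue y x u v} := by
  have hev : ∀ᶠ ε in 𝓝[>] (0 : ℝ), ∀ p ∈ A ×ˢ A,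
      pairSlope y x u v - ε < pairSlope y x p.1 p.2 →
        pairSlope y x u v ≤ pairSlope y x p.1 p.2 := by
    rw [Filter.eventually_all_finite (hA.prod hA)]
    intro p _
    by_cases hp : pairSlope y x u v ≤ pairSlope y x p.1 p.2
    · exact Eventually.of_forall fun _ _ => hp
    · have : ∀ᶠ ε in 𝓝[>] (0 : ℝ), ε < pairSlope y x u v - pairSlope y x p.1 p.2 :=
        nhdsWithin_le_nhds (eventually_lt_nhds (by linarith))
      filter_upwards [this] with ε hε h1
      linarith
  filter_upwards [hev, self_mem_nhdsWithin] with ε hε hpos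
  have hpos : (0 : ℝ) < ε := hpos
  ext w
  simp only [nearMaxValues, h.maxPairSlope_eq, mem_ofPred_eq, mem_singleton_iff]
  constructor
  · rintro ⟨u', hu, v', hv, hlt, rfl⟩
    have hle := hε (u', v') ⟨hu, hv⟩ hlt
    exact value_unique ⟨hu, hv, fun a ha b hb => (h.le a ha b hb).trans hle⟩ h
  · rintro rfl
    exact ⟨u, h.left_mem, v, h.right_mem, by linarith, rfl⟩

lemma tendsto_sSup (h : IsMaxPair y A x u v) (hA : A.Finite) :
    Tendsto (fun ε => sSup (nearMaxValues y A x ε)) (𝓝[>] 0) (𝓝 (pairValue y x u v)) := by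
  refine tendsto_const_nhds.congr' ?_
  filter_upwards [h.eventually_nearMaxValues hA] with ε hε
  rw [hε, csSup_singleton]

lemma tendsto_sInf (h : IsMaxPair y A x u v) (hA : A.Finite) :
    Tendsto (fun ε => sInf (nearMaxValues y A x ε)) (𝓝[>] 0) (𝓝 (pairValue y x u v)) := by
  refine tendsto_const_nhds.congr' ?_
  filter_upwards [h.eventually_nearMaxValues hA] with ε hε
  rw [hε, csInf_singleton]

lemma pmse_eq (h : IsMaxPair y A x u v) (hA : A.Finite) : pmse y A x = pairValue y x u v :=
  (h.tendsto_sSup hA).limUnder_eq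

end IsMaxPair

lemma isPMSE_pmse (y : Ω → ℝ) (hA : A.Finite) (hne : A.Nonempty) : IsPMSE y A (pmse y A) := by
  intro x
  obtain ⟨u, v, h⟩ := exists_isMaxPair y hA hne x
  rw [h.pmse_eq hA]
  exact ⟨h.tendsto_sSup hA, h.tendsto_sInf hA⟩

lemma pmse_eq_of_mem (y : Ω → ℝ) (hA : A.Finite) (hx : x ∈ A) : pmse y A x = y x := by
  obtain ⟨u, v, h⟩ := exists_isMaxPair y hA ⟨x, hx⟩ x
  rw [h.pmse_eq hA]
  have h1 := h.pairValue_le hx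
  have h2 := h.le_pairValue hx
  simp only [dist_self, mul_zero, add_zero, sub_zero] at h1 h2
  exact le_antisymm h1 h2

lemma pmse_mem_Icc (hA : A.Finite) (hne : A.Nonempty) {a b : ℝ} (hy : ∀ w ∈ A, y w ∈ Icc a b)
    (x : Ω) : pmse y A x ∈ Icc a b := by
  obtain ⟨u, v, h⟩ := exists_isMaxPair y hA hne x
  rw [h.pmse_eq hA]
  have hR := h.slope_nonneg
  constructor
  · have := (hy u h.left_mem).1
    have h2 : 0 ≤ pairSlope y x u v * dist x u := by positivity
    unfold pairValue; linarith
  · have := (hy v h.right_mem).2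
    have h2 : 0 ≤ pairSlope y x u v * dist x v := by positivity
    rw [IsMaxPair.pairValue_eq]; linarith

/-- Only the slope at `x` enters. Compare cones through the maximal pair of whichever point has the
larger slope; replacing the larger slope by the smaller on a nonnegative distance errs in the right
direction. -/
lemma abs_pmse_sub_le (hA : A.Finite) (h : IsMaxPair y A x u v) (x' : Ω) :
    |pmse y A x - pmse y A x'| ≤ pairSlope y x u v * dist x x' := by
  obtain ⟨u', v', h'⟩ := exists_isMaxPair y hA ⟨u, h.left_mem⟩ x'
  rw [h.pmse_eq hA, h'.pmse_eq hA]
  have hR := h.slope_nonneg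
  have hR' := h'.slope_nonneg
  have tri : ∀ w, dist x w ≤ dist x x' + dist x' w := fun w => dist_triangle x x' w
  have hu' := h.pairValue_le h'.left_mem
  have hv' := h.le_pairValue h'.right_mem
  have hu := h'.pairValue_le h.left_mem
  have hv := h'.le_pairValue h.right_mem
  have eu : pairValue y x u v = y u + pairSlope y x u v * dist x u := rfl
  have ev := IsMaxPair.pairValue_eq y x u v
  have eu' : pairValue y x' u' v' = y u' + pairSlope y x' u' v' * dist x' u' := rfl
  have ev' := IsMaxPair.pairValue_eq y x' u' v'
  have tri' : ∀ w, dist x' w ≤ dist x x' + dist x w := fun w => by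
    rw [dist_comm x x']; exact dist_triangle x' x w
  generalize pairSlope y x u v = R at *
  generalize pairSlope y x' u' v' = R' at *
  rw [abs_le]
  rcases le_total R R' with hle | hle
  · constructor
    · have h1 := mul_le_mul_of_nonneg_right hle (dist_nonneg (x := x') (y := v'))
      have h2 := mul_le_mul_of_nonneg_left (tri v') hR
      linarith
    · have h1 := mul_le_mul_of_nonneg_right hle (dist_nonneg (x := x') (y := u'))
      have h2 := mul_le_mul_of_nonneg_left (tri u') hR
      linarith
  · constructor
    · have h1 := mul_le_mul_of_nonneg_right hle (dist_nonneg (x := x') (y := u))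
      have h2 := mul_le_mul_of_nonneg_left (tri' u) hR
      linarith
    · have h1 := mul_le_mul_of_nonneg_right hle (dist_nonneg (x := x') (y := v))
      have h2 := mul_le_mul_of_nonneg_left (tri' v) hR
      linarith

lemma localSlope_pmse_le (hA : A.Finite) (h : IsMaxPair y A x u v) :
    localSlope (pmse y A) x univ ≤ ENNReal.ofReal (pairSlope y x u v) := by
  refine iSup₂_le fun x' _ => ENNReal.ofReal_le_ofReal ?_
  exact div_le_of_le_mul₀ dist_nonneg h.slope_nonneg (abs_pmse_sub_le hA h x')

lemma continuous_pmse (y : Ω → ℝ) (hA : A.Finite) (hne : A.Nonempty) : Continuous (pmse y A) := by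
  rw [Metric.continuous_iff']
  intro x ε hε
  obtain ⟨u, v, h⟩ := exists_isMaxPair y hA hne x
  have hc : Tendsto (fun x' => pairSlope y x u v * dist x x') (𝓝 x) (𝓝 0) := by
    have : Continuous fun x' => pairSlope y x u v * dist x x' := by fun_prop
    simpa using this.tendsto x
  filter_upwards [hc.eventually_lt_const hε] with x' hx'
  rw [dist_comm, Real.dist_eq]
  exact (abs_pmse_sub_le hA h x').trans_lt hx'

/-- Supplies the measurability needed for Markov's inequality. -/
lemma lowerSemicontinuous_localSlope {f : Ω → ℝ} (hf : Continuous f) :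
    LowerSemicontinuous fun x => localSlope f x univ := by
  intro x c hc
  simp only [localSlope, Set.mem_sdiff, mem_univ, true_and, mem_singleton_iff] at hc ⊢
  simp only [lt_iSup_iff] at hc ⊢
  obtain ⟨x', hne, hlt⟩ := hc
  have hd : dist x x' ≠ 0 := dist_ne_zero.2 (Ne.symm hne)
  have hcont : ContinuousAt (fun z => ENNReal.ofReal (|f z - f x'| / dist z x')) x :=
    ENNReal.continuous_ofReal.continuousAt.comp
      (ContinuousAt.div (by fun_prop) (by fun_prop) hd)
  filter_upwards [hcont.eventually_const_lt hlt,
    (isOpen_ne (x := x')).mem_nhds (Ne.symm hne)] with z hz hz'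
  exact ⟨x', Ne.symm hz', hz⟩

end Extension

lemma weakSlope_le_strongSlope {Ω : Type*} [MetricSpace Ω] [MeasurableSpace Ω] [BorelSpace Ω]
    {f : Ω → ℝ} (hf : Continuous f) (μ : Measure Ω) :
    weakSlope f μ univ ≤ strongSlope f μ univ := by
  refine iSup₂_le fun t _ => ?_
  simp only [strongSlope, Measure.restrict_univ, mem_univ, true_and]
  exact mul_meas_ge_le_lintegral (lowerSemicontinuous_localSlope hf).measurable _


/-! ### Computing the extension in quadratic time. -/

noncomputable section Machine

lemma foldl_range_induction {α : Type*} (f : α → ℕ → α) (I : ℕ → α → Prop) (N : ℕ) {a : α}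
    (h0 : I 0 a) (hs : ∀ k < N, ∀ b, I k b → I (k + 1) (f b k)) :
    I N ((List.range N).foldl f a) := by
  induction N with
  | zero => simpa using h0
  | succ N ih =>
    rw [List.range_succ, List.foldl_append]
    exact hs N (Nat.lt_succ_self N) _ (ih fun k hk => hs k (hk.trans (Nat.lt_succ_self N)))

/-- Replace the best pair seen so far by the pair in index registers `1` and `2` if the latter has
a larger slope. -/
def updateProg : Prog :=
  -- Register `3` stays `0`, so `(a, 3)` is the first cell of array `a`. Array `3` keeps the best
  -- slope, array `2` its value, and array `4` a zero that turns addition into copying; arrays `5`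
  -- to `8` are scratch.
  .seq (.arith .sub (5, 3) (1, 2) (1, 1)) <|
  .seq (.arith .add (6, 3) (0, 2) (0, 1)) <|
  .seq (.arith .div (7, 3) (5, 3) (6, 3)) <|
  .ifLt (3, 3) (7, 3)
    (.seq (.arith .add (3, 3) (7, 3) (4, 3)) <|
     .seq (.arith .mul (8, 3) (7, 3) (0, 1)) <|
     .arith .add (2, 3) (1, 1) (8, 3))
    .skip

/-- Scan all pairs of sample points for the maximal slope. -/
def pmseProg : Prog :=
  -- The initial best pair is `(0, 0)`: slope `0`, value the first label.
  .seq (.arith .add (2, 3) (1, 3) (4, 3)) (.loop 1 0 (.loop 2 0 updateProg))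

/-- The slope of a pair in terms of distances and labels. -/
def tabSlope (d l : ℕ → ℝ) (i j : ℕ) : ℝ := (l j - l i) / (d j + d i)

/-- The value of a pair in terms of distances and labels. -/
def tabValue (d l : ℕ → ℝ) (i j : ℕ) : ℝ := l i + tabSlope d l i j * d i

/-- The store holds the input, and the best pair among those satisfying `P`. -/
structure ScanState (n : ℕ) (d l : ℕ → ℝ) (P : ℕ → ℕ → Prop) (s : Store) : Prop where
  idx_zero : s.idx 0 = n
  idx_three : s.idx 3 = 0
  dist : ∀ m, s.cell 0 m = d m
  label : ∀ m, s.cell 1 m = l m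
  zero : s.cell 4 0 = 0
  best : ∃ i < n, ∃ j < n, s.cell 3 0 = tabSlope d l i j ∧ s.cell 2 0 = tabValue d l i j
  le_best : ∀ i < n, ∀ j < n, P i j → tabSlope d l i j ≤ s.cell 3 0

variable {n : ℕ} {d l : ℕ → ℝ} {P Q : ℕ → ℕ → Prop} {s : Store}

lemma ScanState.setIdx (h : ScanState n d l P s) {i : ℕ} (hi : i = 1 ∨ i = 2) (k : ℕ) :
    ScanState n d l P (s.setIdx i k) where
  idx_zero := by rcases hi with rfl | rfl <;> simpa [Store.setIdx] using h.idx_zero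
  idx_three := by rcases hi with rfl | rfl <;> simpa [Store.setIdx] using h.idx_three
  dist := h.dist
  label := h.label
  zero := h.zero
  best := h.best
  le_best := h.le_best

lemma ScanState.mono (h : ScanState n d l P s)
    (hPQ : ∀ i < n, ∀ j < n, Q i j → P i j) : ScanState n d l Q s :=
  { h with le_best := fun i hi j hj hq => h.le_best i hi j hj (hPQ i hi j hj hq) }

/-- The cost is three operations, one comparison, and at most three operations in the branch. -/
lemma ScanState.update (h : ScanState n d l P s) (hi : s.idx 1 < n) (hj : s.idx 2 < n) :
    ScanState n d l (fun i j => P i j ∨ i = s.idx 1 ∧ j = s.idx 2) (updateProg.run s).1 ∧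
      (updateProg.run s).1.idx 1 = s.idx 1 ∧ (updateProg.run s).2 ≤ 7 := by
  have h3 := h.idx_three
  by_cases hlt : s.cell 3 0 < tabSlope d l (s.idx 1) (s.idx 2)
  · have hlt' := hlt
    simp only [tabSlope] at hlt'
    simp only [updateProg, Prog.run, Store.get, Store.set, ArithOp.eval, h3, h.dist,
      h.label, h.zero]
    simp only [and_true, true_and, reduceIte, Nat.reduceEqDiff, false_and, hlt', and_self,
      add_zero, OfNat.one_ne_ofNat, OfNat.zero_ne_ofNat]
    refine ⟨⟨?_, ?_, ?_, ?_, ?_, ?_, ?_⟩, ?_⟩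
    · simpa using h.idx_zero
    · simpa using h3
    · intro m; simpa using h.dist m
    · intro m; simpa using h.label m
    · simpa using h.zero
    · refine ⟨_, hi, _, hj, ?_, ?_⟩
      · simp [tabSlope]
      · simp [tabSlope, tabValue]
    · rintro i hi' j hj' (hp | ⟨rfl, rfl⟩)
      · simpa [tabSlope] using (h.le_best i hi' j hj' hp).trans hlt.le
      · simp [tabSlope]
    · norm_num
  · have hlt' := hlt
    simp only [tabSlope] at hlt'
    simp only [updateProg, Prog.run, Store.get, Store.set, ArithOp.eval, h3, h.dist,
      h.label, h.zero]
    simp only [and_true, true_and, reduceIte, Nat.reduceEqDiff, false_and, hlt', and_self,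
      add_zero, OfNat.one_ne_ofNat, OfNat.zero_ne_ofNat]
    refine ⟨⟨?_, ?_, ?_, ?_, ?_, ?_, ?_⟩, ?_⟩
    · simpa using h.idx_zero
    · simpa using h3
    · intro m; simpa using h.dist m
    · intro m; simpa using h.label m
    · simpa using h.zero
    · obtain ⟨i, hi, j, hj, e1, e2⟩ := h.best
      exact ⟨i, hi, j, hj, by simpa using e1, by simpa using e2⟩
    · rintro i hi' j hj' (hp | ⟨rfl, rfl⟩)
      · simpa using h.le_best i hi' j hj' hp
      · simpa using not_lt.1 hlt
    · norm_num

lemma ScanState.innerLoop (h : ScanState n d l P s) (hi : s.idx 1 < n) :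
    ScanState n d l (fun i j => P i j ∨ i = s.idx 1) ((Prog.loop 2 0 updateProg).run s).1 ∧
      ((Prog.loop 2 0 updateProg).run s).2 ≤ 1 + 8 * n := by
  have key := foldl_range_induction
    (fun (acc : Store × ℕ) k => ((updateProg.run (acc.1.setIdx 2 k)).1,
      acc.2 + 1 + (updateProg.run (acc.1.setIdx 2 k)).2))
    (fun k acc => ScanState n d l (fun i j => P i j ∨ i = s.idx 1 ∧ j < k) acc.1 ∧
      acc.1.idx 1 = s.idx 1 ∧ acc.2 ≤ 1 + 8 * k) n (a := (s, 1))
    ⟨h.mono (by rintro i - j - (hp | ⟨-, hj⟩); exacts [hp, absurd hj (Nat.not_lt_zero j)]), rfl,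
      by simp⟩ ?_
  · simp only [Prog.run, h.idx_zero]
    exact ⟨key.1.mono fun i _ j hj hp => hp.imp_right fun e => ⟨e, hj⟩, key.2.2⟩
  · rintro k hk ⟨t, c⟩ ⟨hs, h1, hc⟩
    have hs' := hs.setIdx (Or.inr rfl : (2 : ℕ) = 1 ∨ 2 = 2) k
    have e1 : (t.setIdx 2 k).idx 1 = s.idx 1 := by simpa [Store.setIdx] using h1
    have e2 : (t.setIdx 2 k).idx 2 = k := by simp [Store.setIdx]
    obtain ⟨g1, g2, g3⟩ := hs'.update (by rw [e1]; exact hi) (by rw [e2]; exact hk)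
    refine ⟨g1.mono ?_, g2.trans e1, ?_⟩
    · rw [e1, e2]
      rintro i - j - (hp | ⟨rfl, hj⟩)
      · exact Or.inl (Or.inl hp)
      · rcases Nat.lt_succ_iff_lt_or_eq.1 hj with hj | rfl
        · exact Or.inl (Or.inr ⟨rfl, hj⟩)
        · exact Or.inr ⟨rfl, rfl⟩
    · dsimp only at hc g3 ⊢; omega

lemma ScanState.outerLoop (h : ScanState n d l (fun _ _ => False) s) :
    ScanState n d l (fun _ _ => True) ((Prog.loop 1 0 (.loop 2 0 updateProg)).run s).1 ∧
      ((Prog.loop 1 0 (.loop 2 0 updateProg)).run s).2 ≤ 1 + (2 + 8 * n) * n := by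
  have key := foldl_range_induction
    (fun (acc : Store × ℕ) k =>
      (((Prog.loop 2 0 updateProg).run (acc.1.setIdx 1 k)).1,
        acc.2 + 1 + ((Prog.loop 2 0 updateProg).run (acc.1.setIdx 1 k)).2))
    (fun k acc => ScanState n d l (fun i _ => i < k) acc.1 ∧ acc.2 ≤ 1 + (2 + 8 * n) * k) n
    (a := (s, 1)) ⟨h.mono (fun i _ j _ hi => absurd hi (Nat.not_lt_zero i)), by simp⟩ ?_
  · rw [Prog.run, h.idx_zero]
    exact ⟨key.1.mono fun i hi j _ _ => hi, key.2⟩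
  · rintro k hk ⟨t, c⟩ ⟨hs, hc⟩
    have hs' := hs.setIdx (Or.inl rfl : (1 : ℕ) = 1 ∨ 1 = 2) k
    have e1 : (t.setIdx 1 k).idx 1 = k := by simp [Store.setIdx]
    obtain ⟨g1, g2⟩ := hs'.innerLoop (by rw [e1]; exact hk)
    refine ⟨g1.mono ?_, ?_⟩
    · rw [e1]
      exact fun i _ j _ hi => Nat.lt_succ_iff_lt_or_eq.1 hi
    · dsimp only at hc g2 ⊢
      rw [Nat.mul_succ]; omega

lemma pmseProg_spec {n : ℕ} (hn : 1 ≤ n) (d l : Fin n → ℝ) :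
    (∃ i j : Fin n, (∀ i' j' : Fin n,
        (l j' - l i') / (d j' + d i') ≤ (l j - l i) / (d j + d i)) ∧
      pmseProg.output (inputStore d l) = l i + (l j - l i) / (d j + d i) * d i) ∧
    pmseProg.time (inputStore d l) ≤ 12 * n ^ 2 := by
  set D : ℕ → ℝ := fun m => (inputStore d l).cell 0 m with hD
  set L : ℕ → ℝ := fun m => (inputStore d l).cell 1 m with hL
  have eD : ∀ i : Fin n, D i = d i := fun i => by simp [hD, inputStore]
  have eL : ∀ i : Fin n, L i = l i := fun i => by simp [hL, inputStore]
  have h0 : ScanState n D L (fun _ _ => False)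
      ((Prog.arith .add (2, 3) (1, 3) (4, 3)).run (inputStore d l)).1 := by
    refine ⟨?_, ?_, ?_, ?_, ?_, ⟨0, hn, 0, hn, ?_, ?_⟩, fun _ _ _ _ h => h.elim⟩ <;>
      simp [Prog.run, Store.set, Store.get, ArithOp.eval, tabSlope, tabValue, hD, hL, inputStore]
  obtain ⟨g1, g2⟩ := h0.outerLoop
  obtain ⟨i, hi, j, hj, e3, e2⟩ := g1.best
  refine ⟨⟨⟨i, hi⟩, ⟨j, hj⟩, fun i' j' => ?_, ?_⟩, ?_⟩
  · have := g1.le_best i' i'.2 j' j'.2 trivial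
    rw [e3] at this
    simpa only [tabSlope, ← eD, ← eL] using this
  · rw [Prog.output, pmseProg, Prog.run, e2]
    simp only [tabSlope, tabValue, ← eD, ← eL]
  · rw [Prog.time, pmseProg, Prog.run]
    have : ((Prog.arith .add (2, 3) (1, 3) (4, 3)).run (inputStore d l)).2 = 1 := rfl
    rw [this]
    -- The total is at most `2 + (2 + 8 n) n`, and `n ≥ 1`.
    nlinarith

end Machine

lemma pmseProg_correct {Ω : Type*} [MetricSpace Ω] {n : ℕ} (hn : 1 ≤ n) (X : Fin n → Ω)
    (y : Ω → ℝ) (x : Ω) :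
    pmseProg.output (inputStore (fun i => dist x (X i)) (fun i => y (X i)))
        = pmse y (range X) x ∧
      pmseProg.time (inputStore (fun i => dist x (X i)) (fun i => y (X i))) ≤ 12 * n ^ 2 := by
  obtain ⟨⟨i, j, hmax, hout⟩, htime⟩ :=
    pmseProg_spec hn (fun i => dist x (X i)) (fun i => y (X i))
  have h : IsMaxPair y (range X) x (X i) (X j) :=
    ⟨mem_range_self i, mem_range_self j, by
      rintro _ ⟨i', rfl⟩ _ ⟨j', rfl⟩; exact hmax i' j'⟩
  exact ⟨by rw [hout, h.pmse_eq (finite_range X)]; rfl, htime⟩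


/-! ### Nets with bounded overlap in doubling spaces. -/

section Nets

variable {Ω : Type*} [MetricSpace Ω] {D : ℕ}

lemma DoublingWith.exists_cover_pow (h : DoublingWith Ω D) (m : ℕ) (x : Ω) {r : ℝ} (hr : 0 < r) :
    ∃ s : Finset Ω, s.card ≤ D ^ m ∧
      Metric.closedBall x r ⊆ ⋃ z ∈ s, Metric.closedBall z (r / 2 ^ m) := by
  classical
  induction m with
  | zero => exact ⟨{x}, by simp, by simp⟩
  | succ m ih =>
    obtain ⟨s, hs, hcov⟩ := ih
    choose t ht using fun z => h z (r / 2 ^ m) (by positivity)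
    refine ⟨s.biUnion t, ?_, fun w hw => ?_⟩
    · rw [pow_succ]
      exact Finset.card_biUnion_le_card_mul _ _ _ (fun z _ => (ht z).1) |>.trans
        (Nat.mul_le_mul_right _ hs)
    · obtain ⟨z, hz, hwz⟩ := mem_iUnion₂.1 (hcov hw)
      obtain ⟨z', hz', hwz'⟩ := mem_iUnion₂.1 ((ht z).2 hwz)
      refine mem_iUnion₂.2 ⟨z', Finset.mem_biUnion.2 ⟨z, hz, hz'⟩, ?_⟩
      rwa [pow_succ, ← div_div]

/-- In a doubling space a separated set in a ball is small. -/
lemma DoublingWith.card_le_of_separated (h : DoublingWith Ω D) {T : Finset Ω} {r R : ℝ} {m : ℕ}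
    (hR : 0 < R) (hm : R / 2 ^ m ≤ r / 2) (hT : (T : Set Ω).Pairwise fun a b => r < dist a b)
    {p : Ω} (hp : ∀ z ∈ T, dist z p ≤ R) : T.card ≤ D ^ m := by
  classical
  obtain ⟨s, hs, hcov⟩ := h.exists_cover_pow m p hR
  have : ∀ z ∈ T, ∃ c ∈ s, dist z c ≤ R / 2 ^ m := fun z hz => by
    simpa using mem_iUnion₂.1 (hcov (Metric.mem_closedBall.2 (hp z hz)))
  choose! c hc hd using this
  -- Two points with the same covering centre are within `r` of each other.
  refine (Finset.card_le_card_of_injOn c hc fun a ha b hb hab => ?_).trans hs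
  by_contra hne
  have h1 := hT ha hb hne
  have h2 := hd a ha
  have h3 := hd b hb
  rw [← hab] at h3
  have := dist_triangle_right a b (c a)
  linarith

/-- A separated set of largest cardinality is a net, since an uncovered point could be added to it.
-/
lemma DoublingWith.exists_net (h : DoublingWith Ω D) (hdiam : ∀ x x' : Ω, dist x x' ≤ 1) (k : ℕ) :
    ∃ T : Finset Ω, T.card ≤ D ^ (k + 1) ∧ (∀ x, ∃ z ∈ T, dist x z ≤ (1 / 2) ^ k) ∧
      ∀ p, (T.filter fun z => dist z p ≤ 8 * (1 / 2) ^ k).card ≤ D ^ 4 := by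
  classical
  have hsmall : ∀ T : Finset Ω, ((T : Set Ω).Pairwise fun a b => (1 / 2 : ℝ) ^ k < dist a b) →
      T.card ≤ D ^ (k + 1) := by
    intro T hT
    rcases T.eq_empty_or_nonempty with rfl | ⟨p, -⟩
    · simp
    · refine h.card_le_of_separated one_pos ?_ hT (fun z _ => hdiam z p)
      rw [pow_succ, one_div_pow]; apply le_of_eq; field_simp
  obtain ⟨T, hT, hmax⟩ : ∃ T : Finset Ω,
      ((T : Set Ω).Pairwise fun a b => (1 / 2 : ℝ) ^ k < dist a b) ∧
      ∀ T' : Finset Ω, ((T' : Set Ω).Pairwise fun a b => (1 / 2 : ℝ) ^ k < dist a b) →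
        T'.card ≤ T.card := by
    have hne : ∃ m, ∃ T : Finset Ω,
        ((T : Set Ω).Pairwise fun a b => (1 / 2 : ℝ) ^ k < dist a b) ∧ T.card = m :=
      ⟨0, ∅, by simp, rfl⟩
    obtain ⟨m, ⟨⟨T, hT, hm⟩, hmax⟩⟩ := BddAbove.exists_isGreatest_of_nonempty
      (S := {m | ∃ T : Finset Ω,
        ((T : Set Ω).Pairwise fun a b => (1 / 2 : ℝ) ^ k < dist a b) ∧ T.card = m})
      ⟨D ^ (k + 1), by rintro m ⟨T, hT, rfl⟩; exact hsmall T hT⟩ hne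
    exact ⟨T, hT, fun T' hT' => hm ▸ hmax ⟨T', hT', rfl⟩⟩
  refine ⟨T, hsmall T hT, fun x => ?_, fun p => ?_⟩
  · by_contra! hx
    have hxT : x ∉ T := fun hxT => by
      have := hx x hxT
      rw [dist_self] at this
      exact absurd this (not_lt.2 (by positivity))
    have := hmax (insert x T) (by
      rw [Finset.coe_insert]
      refine hT.insert fun b hb _ => ⟨hx b hb, ?_⟩
      rw [dist_comm]; exact hx b hb)
    rw [Finset.card_insert_of_notMem hxT] at this
    omega
  -- Four halvings bring `8 · 2^-k` down to half the separation, hence `D ^ 4`.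
  · refine h.card_le_of_separated (r := (1 / 2) ^ k) (R := 8 * (1 / 2) ^ k) (m := 4)
      (by positivity) (by apply le_of_eq; ring) ?_ (p := p)
      (fun z hz => (Finset.mem_filter.1 hz).2)
    exact hT.mono fun z hz => (Finset.mem_filter.1 hz).1

end Nets


/-! ### Empirical masses dominate true masses. -/

section Concentration

variable {Ω : Type*} [MeasurableSpace Ω] (μ : Measure Ω) [IsProbabilityMeasure μ]

-- The integral equals `1 - μ(B) / 2`. Its `n`-fold product is the exponential moment of minus the
-- count of sample points in `B`.
open Classical in
lemma lintegral_ite_half_le {B : Set Ω} (hB : MeasurableSet B) :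
    ∫⁻ x, (if x ∈ B then (2 : ℝ≥0∞)⁻¹ else 1) ∂μ ≤ ENNReal.ofReal (Real.exp (-(μ.real B / 2))) := by
  have h1 : ∫⁻ x, (if x ∈ B then (2 : ℝ≥0∞)⁻¹ else 1) ∂μ
      = ENNReal.ofReal (1 - μ.real B / 2) := by
    have : (fun x => if x ∈ B then (2 : ℝ≥0∞)⁻¹ else 1)
        = fun x => B.indicator (fun _ => 2⁻¹) x + Bᶜ.indicator (fun _ => 1) x := by
      ext x; by_cases hx : x ∈ B <;> simp [hx]
    rw [this, lintegral_add_left (measurable_const.indicator hB), lintegral_indicator_const hB,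
      lintegral_indicator_const hB.compl, ← ofReal_measureReal (s := B),
      ← ofReal_measureReal (s := Bᶜ), probReal_compl_eq_one_sub hB, one_mul,
      show (2 : ℝ≥0∞)⁻¹ = ENNReal.ofReal (2⁻¹) by
        rw [ENNReal.ofReal_inv_of_pos two_pos]; simp,
      ← ENNReal.ofReal_mul (by norm_num),
      ← ENNReal.ofReal_add (by positivity) (by linarith [measureReal_le_one (μ := μ) (s := B)])]
    congr 1; ring
  rw [h1]
  refine ENNReal.ofReal_le_ofReal ?_
  linarith [Real.add_one_le_exp (-(μ.real B / 2))]

open Classical in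
lemma lintegral_prod_ite_half_le {B : Set Ω} (hB : MeasurableSet B) (n : ℕ) :
    ∫⁻ X, ∏ i, (if X i ∈ B then (2 : ℝ≥0∞)⁻¹ else 1) ∂(Measure.pi fun _ : Fin n => μ)
      ≤ ENNReal.ofReal (Real.exp (-(n * μ.real B / 2))) := by
  have hg : Measurable fun x : Ω => if x ∈ B then (2 : ℝ≥0∞)⁻¹ else 1 :=
    Measurable.ite hB measurable_const measurable_const
  have hind := ProbabilityTheory.iIndepFun_pi (μ := fun _ : Fin n => μ)
    (X := fun _ x => if x ∈ B then (2 : ℝ≥0∞)⁻¹ else 1) (fun _ => hg.aemeasurable)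
  rw [ProbabilityTheory.lintegral_prod_eq_prod_lintegral_of_indepFun Finset.univ
    (fun i (X : Fin n → Ω) => if X i ∈ B then (2 : ℝ≥0∞)⁻¹ else 1) hind
    (fun i => hg.comp (measurable_pi_apply i))]
  have : ∀ i : Fin n, ∫⁻ X, (if X i ∈ B then (2 : ℝ≥0∞)⁻¹ else 1) ∂(Measure.pi fun _ : Fin n => μ)
      ≤ ENNReal.ofReal (Real.exp (-(μ.real B / 2))) := fun i => by
    rw [(measurePreserving_eval (fun _ : Fin n => μ) i).lintegral_comp hg]
    exact lintegral_ite_half_le μ hB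
  refine (Finset.prod_le_prod' fun i _ => this i).trans ?_
  rw [Finset.prod_const, Finset.card_univ, Fintype.card_fin, ← ENNReal.ofReal_pow (Real.exp_pos _).le,
    ← Real.exp_nat_mul]
  apply le_of_eq; congr 2; ring

open Classical in
/-- With high probability, the mass of every set in a finite family is dominated by its empirical
mass, up to a logarithmic error. -/
lemma exists_uniform_event {ι : Type*} (T : Finset ι) (B : ι → Set Ω)
    (hB : ∀ c ∈ T, MeasurableSet (B c)) {n : ℕ} (hn : 1 ≤ n) {N : ℝ} (hN : 0 < N)
    (hcard : (T.card : ℝ) ≤ N) :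
    ∃ E : Set (Fin n → Ω), MeasurableSet E ∧
      ENNReal.ofReal (1 - 1 / n) ≤ Measure.pi (fun _ : Fin n => μ) E ∧
      ∀ X ∈ E, ∀ c ∈ T, n * μ.real (B c)
        ≤ 2 * (Finset.univ.filter fun i => X i ∈ B c).card + 2 * Real.log (N * n) := by
  have hn0 : (0 : ℝ) < n := by exact_mod_cast hn
  -- Normalized so that each `F c` has mean at most `1`; the sum over `T` then has mean at most `N`.
  set F : ι → (Fin n → Ω) → ℝ≥0∞ := fun c X => ENNReal.ofReal (Real.exp (n * μ.real (B c) / 2)) *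
    ∏ i, (if X i ∈ B c then (2 : ℝ≥0∞)⁻¹ else 1) with hF
  have hpm : ∀ c ∈ T, Measurable fun X : Fin n → Ω =>
      ∏ i, (if X i ∈ B c then (2 : ℝ≥0∞)⁻¹ else 1) := fun c hc =>
    Finset.measurable_fun_prod _ fun i _ =>
      Measurable.ite (measurable_pi_apply i (hB c hc)) measurable_const measurable_const
  have hFm : ∀ c ∈ T, Measurable (F c) := fun c hc => (hpm c hc).const_mul _
  have hGm : Measurable fun X => ∑ c ∈ T, F c X := Finset.measurable_fun_sum _ hFm
  have hint : ∫⁻ X, ∑ c ∈ T, F c X ∂(Measure.pi fun _ : Fin n => μ) ≤ ENNReal.ofReal N := by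
    rw [lintegral_finsetSum' _ fun c hc => (hFm c hc).aemeasurable]
    have h1 : ∀ c ∈ T, ∫⁻ X, F c X ∂(Measure.pi fun _ : Fin n => μ) ≤ 1 := fun c hc => by
      rw [hF, lintegral_const_mul _ (hpm c hc)]
      refine (mul_le_mul_right (lintegral_prod_ite_half_le μ (hB c hc) n) _).trans ?_
      rw [← ENNReal.ofReal_mul (Real.exp_pos _).le, ← Real.exp_add]
      simp
    refine (Finset.sum_le_sum h1).trans ?_
    rw [Finset.sum_const, nsmul_one, ← ENNReal.ofReal_natCast]
    exact ENNReal.ofReal_le_ofReal hcard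
  refine ⟨{X | ENNReal.ofReal (N * n) ≤ ∑ c ∈ T, F c X}ᶜ,
    (measurableSet_le measurable_const hGm).compl, ?_, fun X hX c hc => ?_⟩
  -- A single Markov inequality for the sum replaces a union bound over `T`.
  · have hmarkov := (mul_meas_ge_le_lintegral (μ := Measure.pi fun _ : Fin n => μ) hGm
      (ENNReal.ofReal (N * n))).trans hint
    have hle : Measure.pi (fun _ : Fin n => μ) {X | ENNReal.ofReal (N * n) ≤ ∑ c ∈ T, F c X}
        ≤ ENNReal.ofReal (1 / n) := by
      have h2 : ENNReal.ofReal (1 / n) = ENNReal.ofReal N / ENNReal.ofReal (N * n) := by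
        rw [← ENNReal.ofReal_div_of_pos (by positivity)]; congr 1; field_simp
      rw [h2, ENNReal.le_div_iff_mul_le (Or.inl (by simp; positivity)) (Or.inl (by simp)), mul_comm]
      exact hmarkov
    rw [prob_compl_eq_one_sub (measurableSet_le measurable_const hGm),
      ENNReal.ofReal_sub _ (by positivity), ENNReal.ofReal_one]
    exact tsub_le_tsub_left hle 1
  · have hlt : F c X < ENNReal.ofReal (N * n) :=
      (Finset.single_le_sum (f := fun c => F c X) (fun _ _ => zero_le) hc).trans_lt (not_le.1 hX)
    have hprod : ∏ i, (if X i ∈ B c then (2 : ℝ≥0∞)⁻¹ else 1)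
        = ENNReal.ofReal (Real.exp
          (-((Finset.univ.filter fun i => X i ∈ B c).card * Real.log 2))) := by
      rw [Finset.prod_ite, Finset.prod_const, Finset.prod_const_one, mul_one, Real.exp_neg,
        Real.exp_nat_mul, Real.exp_log two_pos, ENNReal.ofReal_inv_of_pos (by positivity),
        ENNReal.ofReal_pow two_pos.le, ENNReal.inv_pow]
      simp
    simp only [hF] at hlt
    rw [hprod, ← ENNReal.ofReal_mul (Real.exp_pos _).le, ← Real.exp_add,
      ENNReal.ofReal_lt_ofReal_iff (by positivity), ← Real.lt_log_iff_exp_lt (by positivity)] at hlt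
    have hl2 : Real.log 2 ≤ 1 := by linarith [Real.log_two_lt_d9]
    have := mul_le_mul_of_nonneg_left hl2
      (Nat.cast_nonneg (α := ℝ) (Finset.univ.filter fun i => X i ∈ B c).card)
    linarith

end Concentration


/-! ### Weak and strong averages over the sample. -/

section WeakStrong

/-- The least of `m` values is at most `M / m`; remove it and induct. -/
lemma sum_le_mul_harmonic {ι : Type*} (s : Finset ι) (a : ι → ℝ≥0∞) (M : ℝ≥0∞)
    (h : ∀ i ∈ s, a i * (s.filter fun j => a i ≤ a j).card ≤ M) :
    ∑ i ∈ s, a i ≤ M * ∑ k ∈ Finset.range s.card, ((k + 1 : ℕ) : ℝ≥0∞)⁻¹ := by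
  classical
  induction s using Finset.induction_on_min_value a with
  | empty => simp
  | insert m s hm hmin ih =>
    rw [Finset.sum_insert hm, Finset.card_insert_of_notMem hm, Finset.sum_range_succ, mul_add,
      add_comm]
    refine add_le_add (ih fun i hi => le_trans ?_ (h i (Finset.mem_insert_of_mem hi))) ?_
    · gcongr
      exact Finset.subset_insert _ _
    · have h1 := h m (Finset.mem_insert_self _ _)
      rw [Finset.filter_true_of_mem, Finset.card_insert_of_notMem hm] at h1
      · rw [← div_eq_mul_inv, ENNReal.le_div_iff_mul_le (Or.inl (by simp)) (Or.inl (by simp))]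
        exact h1
      · intro j hj
        rcases Finset.mem_insert.1 hj with rfl | hj
        · exact le_rfl
        · exact hmin j hj

lemma sum_inv_le_one_add_log (n : ℕ) :
    ∑ k ∈ Finset.range n, ((k + 1 : ℕ) : ℝ≥0∞)⁻¹ ≤ ENNReal.ofReal (1 + Real.log n) := by
  have : ∑ k ∈ Finset.range n, ((k + 1 : ℕ) : ℝ≥0∞)⁻¹ = ENNReal.ofReal (harmonic n) := by
    rw [harmonic, Rat.cast_sum, ENNReal.ofReal_sum_of_nonneg fun i _ => by positivity]
    refine Finset.sum_congr rfl fun k _ => ?_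
    rw [Rat.cast_inv, ENNReal.ofReal_inv_of_pos (by positivity), Rat.cast_natCast, ENNReal.ofReal_natCast]
  rw [this]
  exact ENNReal.ofReal_le_ofReal (harmonic_le_one_add_log n)

variable {Ω : Type*} [MetricSpace Ω] [MeasurableSpace Ω] [BorelSpace Ω]
  {n : ℕ} (X : Fin n → Ω) (y : Ω → ℝ)

lemma strongSlope_empiricalMeasure :
    strongSlope y (empiricalMeasure X) (range X)
      = (n : ℝ≥0∞)⁻¹ * ∑ i, localSlope y (X i) (range X) := by
  have hmem : ∀ᵐ x ∂(empiricalMeasure X), x ∈ range X := by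
    refine Measure.ae_smul_measure ?_ _
    rw [ae_iff, Measure.finsetSum_apply, Finset.sum_eq_zero]
    intro i _
    rw [Measure.dirac_apply, Set.indicator_of_notMem]
    simp
  rw [strongSlope, Measure.restrict_eq_self_of_ae_mem hmem, empiricalMeasure,
    lintegral_smul_measure, lintegral_finsetSum_measure]
  simp

lemma ofReal_mul_card_le_weakSlope (t : ℝ) (ht : 0 < t) :
    ENNReal.ofReal t * ((n : ℝ≥0∞)⁻¹ *
      (Finset.univ.filter fun i => ENNReal.ofReal t ≤ localSlope y (X i) (range X)).card)
      ≤ weakSlope y (empiricalMeasure X) (range X) := by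
  have : empiricalMeasure X {x ∈ range X | ENNReal.ofReal t ≤ localSlope y x (range X)}
      = (n : ℝ≥0∞)⁻¹ *
      (Finset.univ.filter fun i => ENNReal.ofReal t ≤ localSlope y (X i) (range X)).card := by
    rw [empiricalMeasure, Measure.smul_apply, Measure.finsetSum_apply, smul_eq_mul]
    congr 1
    rw [Finset.card_filter, Nat.cast_sum]
    refine Finset.sum_congr rfl fun i _ => ?_
    rw [Measure.dirac_apply]
    by_cases h : ENNReal.ofReal t ≤ localSlope y (X i) (range X) <;> simp [h]
  rw [← this]
  exact le_iSup₂ (f := fun (t : ℝ) (_ : 0 < t) => ENNReal.ofReal t *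
    empiricalMeasure X {x ∈ range X | ENNReal.ofReal t ≤ localSlope y x (range X)}) t ht

variable {X y}

/-- One sample point of slope at least `t` already makes the weak average at least `t / n`. -/
lemma localSlope_le_sq (hn : 1 ≤ n)
    (hw : weakSlope y (empiricalMeasure X) (range X) ≤ n) (i : Fin n) :
    localSlope y (X i) (range X) ≤ ENNReal.ofReal ((n : ℝ) ^ 2) := by
  by_contra! hlt
  obtain ⟨t, ht1, ht2⟩ := ENNReal.lt_iff_exists_nnreal_btwn.1 hlt
  have hn0 : (n : ℝ≥0∞) ≠ 0 := by simp; omega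
  rw [ENNReal.ofReal_lt_coe_iff (by positivity)] at ht1
  have ht0 : 0 < (t : ℝ) := lt_of_le_of_lt (by positivity) ht1
  have h1 := (ofReal_mul_card_le_weakSlope X y t ht0).trans hw
  have hcard : 1 ≤ (Finset.univ.filter fun i =>
      ENNReal.ofReal t ≤ localSlope y (X i) (range X)).card :=
    Finset.card_pos.2 ⟨i, Finset.mem_filter.2 ⟨Finset.mem_univ i, by simpa using ht2.le⟩⟩
  have h2 : ENNReal.ofReal t * ((n : ℝ≥0∞)⁻¹ * 1) ≤ n := by
    refine le_trans ?_ h1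
    gcongr
    exact_mod_cast hcard
  rw [mul_one, ← div_eq_mul_inv, ENNReal.div_le_iff hn0 (by simp), ← Nat.cast_mul,
    ENNReal.ofReal_le_natCast] at h2
  push_cast at h2
  nlinarith

lemma strongSlope_le_weakSlope (hn : 1 ≤ n)
    (hw : weakSlope y (empiricalMeasure X) (range X) ≤ n) :
    strongSlope y (empiricalMeasure X) (range X)
      ≤ ENNReal.ofReal (1 + Real.log n) * weakSlope y (empiricalMeasure X) (range X) := by
  have hn0 : (n : ℝ≥0∞) ≠ 0 := by simp; omega
  rw [strongSlope_empiricalMeasure]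
  set W := weakSlope y (empiricalMeasure X) (range X)
  have key := sum_le_mul_harmonic Finset.univ (fun i => localSlope y (X i) (range X))
    (W * n) ?_
  · rw [Finset.card_univ, Fintype.card_fin] at key
    calc _ ≤ (n : ℝ≥0∞)⁻¹ * (W * n * ENNReal.ofReal (1 + Real.log n)) := by
          gcongr; exact key.trans (mul_le_mul_right (sum_inv_le_one_add_log n) _)
      _ = ((n : ℝ≥0∞)⁻¹ * n) * (ENNReal.ofReal (1 + Real.log n) * W) := by ring
      _ = _ := by rw [ENNReal.inv_mul_cancel hn0 (by simp), one_mul]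
  · intro i _
    rcases eq_or_ne (localSlope y (X i) (range X)) 0 with h0 | h0
    · simp [h0]
    · have hfin : localSlope y (X i) (range X) ≠ ⊤ :=
        ((localSlope_le_sq hn hw i).trans_lt ENNReal.ofReal_lt_top).ne
      have := ofReal_mul_card_le_weakSlope X y _ (ENNReal.toReal_pos h0 hfin)
      rw [ENNReal.ofReal_toReal hfin] at this
      rw [← ENNReal.div_le_iff hn0 (by simp), div_eq_mul_inv, mul_assoc, mul_comm (Nat.cast _)]
      exact this

end WeakStrong


/-! ### Charging the slope of the extension to the sample. -/

section Integration

variable {Ω : Type*} [MetricSpace Ω] {n : ℕ} {X : Fin n → Ω} {y : Ω → ℝ}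

lemma one_le_localSlope_mul_dist {i : Fin n} {w : Ω} (hw : w ∈ range X)
    (hfin : localSlope y (X i) (range X) ≠ ⊤) (h : |y (X i) - y w| = 1) :
    1 ≤ (localSlope y (X i) (range X)).toReal * dist (X i) w := by
  have hne : w ≠ X i := by rintro rfl; simp at h
  have hd : 0 < dist (X i) w := dist_pos.2 hne.symm
  have h1 : ENNReal.ofReal (|y (X i) - y w| / dist (X i) w) ≤ localSlope y (X i) (range X) :=
    le_iSup₂ (f := fun x' (_ : x' ∈ range X \ {X i}) =>
      ENNReal.ofReal (|y (X i) - y x'| / dist (X i) x')) w ⟨hw, hne⟩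
  rw [h, ENNReal.ofReal_le_iff_le_toReal hfin, div_le_iff₀ hd] at h1
  exact h1

variable {x u v : Ω}

lemma IsMaxPair.labels (hy : ∀ i, y (X i) = 0 ∨ y (X i) = 1) (h : IsMaxPair y (range X) x u v)
    (hR : 0 < pairSlope y x u v) : y u = 0 ∧ y v = 1 := by
  obtain ⟨⟨i, rfl⟩, ⟨j, rfl⟩, -⟩ := h
  have hpos : 0 < y (X j) - y (X i) := by
    by_contra hle
    exact absurd hR (not_lt.2 (div_nonpos_of_nonpos_of_nonneg (not_lt.1 hle) (by positivity)))
  rcases hy i with hi | hi <;> rcases hy j with hj | hj <;> rw [hi, hj] at hpos <;>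
    norm_num at hpos
  exact ⟨hi, hj⟩

/-- One member `w` of the maximal pair has the label opposite to that of `X i`; `w'` is the other
member. -/
lemma IsMaxPair.exists_opposite (hy : ∀ i, y (X i) = 0 ∨ y (X i) = 1)
    (h : IsMaxPair y (range X) x u v) (hR : 0 < pairSlope y x u v) (i : Fin n) :
    ∃ w ∈ range X, ∃ w' ∈ range X, |y (X i) - y w| = 1 ∧
      dist x v + dist x u = dist x w + dist x w' := by
  obtain ⟨hu, hv⟩ := h.labels hy hR
  rcases hy i with hi | hi
  · exact ⟨v, h.right_mem, u, h.left_mem, by simp [hi, hv], rfl⟩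
  · exact ⟨u, h.left_mem, v, h.right_mem, by simp [hi, hu], add_comm _ _⟩

lemma IsMaxPair.slope_mul_dist (hy : ∀ i, y (X i) = 0 ∨ y (X i) = 1)
    (h : IsMaxPair y (range X) x u v) (hR : 0 < pairSlope y x u v) :
    pairSlope y x u v * (dist x v + dist x u) = 1 := by
  obtain ⟨hu, hv⟩ := h.labels hy hR
  rw [pairSlope_mul, hu, hv, sub_zero]

/-- The slope of the extension is controlled by the slope of the labels at a nearest neighbour. -/
lemma IsMaxPair.slope_le_nearest (hy : ∀ i, y (X i) = 0 ∨ y (X i) = 1)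
    (h : IsMaxPair y (range X) x u v) (hR : 0 < pairSlope y x u v) {i : Fin n}
    (hfin : localSlope y (X i) (range X) ≠ ⊤) (hi : ∀ j, dist x (X i) ≤ dist x (X j)) :
    pairSlope y x u v ≤ (localSlope y (X i) (range X)).toReal := by
  obtain ⟨w, hw, w', ⟨j, rfl⟩, h1, h2⟩ := h.exists_opposite hy hR i
  have h3 := one_le_localSlope_mul_dist hw hfin h1
  have h4 := h.slope_mul_dist hy hR
  -- Go from `X i` to `w` through `x`; `X i` is no farther from `x` than `w'` is.
  have h5 : dist (X i) w ≤ dist x v + dist x u := by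
    rw [h2]
    linarith [dist_triangle_left (X i) w x, hi j]
  have h6 := mul_le_mul_of_nonneg_left h5
    (ENNReal.toReal_nonneg (a := localSlope y (X i) (range X)))
  have h7 := mul_le_mul_of_nonneg_left (h3.trans h6) hR.le
  calc pairSlope y x u v = pairSlope y x u v * 1 := (mul_one _).symm
    _ ≤ _ := h7
    _ = (localSlope y (X i) (range X)).toReal * (pairSlope y x u v * (dist x v + dist x u)) := by
      ring
    _ = _ := by rw [h4, mul_one]

/-- Within the resolution of the sample, the slope of the extension is controlled by the slope of
the labels at any near sample point. -/
lemma IsMaxPair.slope_le_of_near (hn : 1 ≤ n) (hy : ∀ i, y (X i) = 0 ∨ y (X i) = 1)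
    (h : IsMaxPair y (range X) x u v) (hR : 0 < pairSlope y x u v)
    (hle : ∀ i, localSlope y (X i) (range X) ≤ ENNReal.ofReal ((n : ℝ) ^ 2)) {i : Fin n} {r : ℝ}
    (hr : r * n ^ 2 ≤ 1) (hi : dist x (X i) ≤ 3 * r) :
    pairSlope y x u v ≤ 4 * (localSlope y (X i) (range X)).toReal := by
  have hn0 : (0 : ℝ) < n := by exact_mod_cast hn
  have hfin : ∀ i, localSlope y (X i) (range X) ≠ ⊤ := fun i =>
    ((hle i).trans_lt ENNReal.ofReal_lt_top).ne
  have h4 := h.slope_mul_dist hy hR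
  -- Slopes at most `n²` keep opposite labels `1 / n²` apart, and `r ≤ 1 / n²`.
  have hS : r ≤ dist x v + dist x u := by
    obtain ⟨hu, hv⟩ := h.labels hy hR
    obtain ⟨j, rfl⟩ := h.left_mem
    have h3 := one_le_localSlope_mul_dist h.right_mem (hfin j) (by simp [hu, hv])
    have h5 : (localSlope y (X j) (range X)).toReal ≤ (n : ℝ) ^ 2 :=
      ENNReal.toReal_le_of_le_ofReal (by positivity) (hle j)
    have h6 : dist (X j) v ≤ dist x v + dist x (X j) := by
      linarith [dist_triangle_left (X j) v x]
    have h7 : r * (n : ℝ) ^ 2 ≤ (dist x v + dist x (X j)) * (n : ℝ) ^ 2 := by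
      calc r * (n : ℝ) ^ 2 ≤ 1 := hr
        _ ≤ _ := h3
        _ ≤ (n : ℝ) ^ 2 * (dist x v + dist x (X j)) := by gcongr
        _ = _ := mul_comm _ _
    exact le_of_mul_le_mul_right h7 (by positivity)
  obtain ⟨w, hw, w', -, h1, h2⟩ := h.exists_opposite hy hR i
  have h3 := one_le_localSlope_mul_dist hw (hfin i) h1
  have h5 : dist (X i) w ≤ 4 * (dist x v + dist x u) := by
    linarith [dist_triangle_left (X i) w x, dist_nonneg (x := x) (y := w')]
  have h6 := mul_le_mul_of_nonneg_left h5
    (ENNReal.toReal_nonneg (a := localSlope y (X i) (range X)))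
  have h7 := mul_le_mul_of_nonneg_left (h3.trans h6) hR.le
  calc pairSlope y x u v = pairSlope y x u v * 1 := (mul_one _).symm
    _ ≤ _ := h7
    _ = 4 * (localSlope y (X i) (range X)).toReal *
          (pairSlope y x u v * (dist x v + dist x u)) := by ring
    _ = _ := by rw [h4, mul_one]

/-- Take the first power of `1 / 2` below `d`; if it is the zeroth, `d ≤ 1` gives the upper bound.
-/
lemma exists_dyadic_scale {d : ℝ} (hd : d ≤ 1) {K : ℕ} (hK : (1 / 2) ^ K < d) :
    ∃ m ≤ K, (1 / 2) ^ m < d ∧ d ≤ 2 * (1 / 2) ^ m := by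
  classical
  have hex : ∃ m : ℕ, (1 / 2 : ℝ) ^ m < d := ⟨K, hK⟩
  refine ⟨Nat.find hex, Nat.find_min' hex hK, Nat.find_spec hex, ?_⟩
  rcases hm : Nat.find hex with _ | m
  · norm_num; linarith
  · have := Nat.find_min hex (m := m) (by omega)
    rw [pow_succ]; linarith [not_lt.1 this]

open Classical in
/-- Every point lies in a ball of one of the nets on which the slope of the extension is controlled
by the slopes of the labels at the sample points near that ball. -/
lemma exists_net_ball (hn : 1 ≤ n) (hdiam : ∀ x x' : Ω, dist x x' ≤ 1)
    (hy : ∀ i, y (X i) = 0 ∨ y (X i) = 1)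
    (hle : ∀ i, localSlope y (X i) (range X) ≤ ENNReal.ofReal ((n : ℝ) ^ 2))
    {K : ℕ} (hK : n ^ 2 ≤ 2 ^ K) {T : ℕ → Finset Ω}
    (hT : ∀ k x, ∃ z ∈ T k, dist x z ≤ (1 / 2) ^ k) {b : ℝ} (hb : 0 ≤ b)
    (h : IsMaxPair y (range X) x u v) :
    ∃ k ∈ Finset.range (K + 2), ∃ z ∈ T k, dist x z ≤ (1 / 2) ^ k ∧
      pairSlope y x u v *
          (2 * (Finset.univ.filter fun i => X i ∈ Metric.closedBall z ((1 / 2) ^ k)).card + b)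
        ≤ (8 + 4 * b) * ∑ i with dist z (X i) ≤ 8 * (1 / 2) ^ k,
            (localSlope y (X i) (range X)).toReal := by
  have hfin : ∀ i, localSlope y (X i) (range X) ≠ ⊤ := fun i =>
    ((hle i).trans_lt ENNReal.ofReal_lt_top).ne
  set Λ : Fin n → ℝ := fun i => (localSlope y (X i) (range X)).toReal with hΛ
  have hΛ0 : ∀ i, 0 ≤ Λ i := fun i => ENNReal.toReal_nonneg
  have hsum0 : ∀ z k, 0 ≤ ∑ i with dist z (X i) ≤ 8 * (1 / 2 : ℝ) ^ k, Λ i := fun z k =>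
    Finset.sum_nonneg fun i _ => hΛ0 i
  have hsingle : ∀ z k i, dist z (X i) ≤ 8 * (1 / 2 : ℝ) ^ k →
      Λ i ≤ ∑ i with dist z (X i) ≤ 8 * (1 / 2 : ℝ) ^ k, Λ i := fun z k i hi =>
    Finset.single_le_sum (f := Λ) (fun i _ => hΛ0 i)
      (Finset.mem_filter.2 ⟨Finset.mem_univ i, hi⟩)
  rcases h.slope_nonneg.eq_or_lt with h0 | hR
  · obtain ⟨z, hz, hxz⟩ := hT 0 x
    refine ⟨0, by simp, z, hz, hxz, ?_⟩
    rw [← h0, zero_mul]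
    exact mul_nonneg (by linarith) (hsum0 z 0)
  have : NeZero n := ⟨by omega⟩
  obtain ⟨i, -, hi⟩ := Finset.exists_min_image Finset.univ (fun i => dist x (X i))
    ⟨(0 : Fin n), Finset.mem_univ _⟩
  have hnear := h.slope_le_nearest hy hR (hfin i) (fun j => hi j (Finset.mem_univ j))
  change pairSlope y x u v ≤ Λ i at hnear
  -- Near the sample: the count costs `2 · 4` times the sum of slopes, and `b` is paid by the
  -- nearest point.
  by_cases hfine : dist x (X i) ≤ (1 / 2) ^ K
  · obtain ⟨z, hz, hxz⟩ := hT K x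
    have hr0 : (0 : ℝ) < (1 / 2) ^ K := by positivity
    have hr : (1 / 2 : ℝ) ^ K * n ^ 2 ≤ 1 := by
      rw [one_div_pow, one_div_mul_eq_div, div_le_one (by positivity)]
      exact_mod_cast hK
    refine ⟨K, by simp, z, hz, hxz, ?_⟩
    have h1 : pairSlope y x u v *
        (Finset.univ.filter fun i => X i ∈ Metric.closedBall z ((1 / 2) ^ K)).card
        ≤ 4 * ∑ i with dist z (X i) ≤ 8 * (1 / 2 : ℝ) ^ K, Λ i := by
      rw [mul_comm, ← nsmul_eq_mul, ← Finset.sum_const, Finset.mul_sum]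
      refine (Finset.sum_le_sum (g := fun j => 4 * Λ j) fun j hj => ?_).trans
        (Finset.sum_le_sum_of_subset_of_nonneg (fun j hj => ?_)
          fun j _ _ => mul_nonneg (by norm_num) (hΛ0 j))
      · have hj' := Metric.mem_closedBall.1 (Finset.mem_filter.1 hj).2
        refine h.slope_le_of_near hn hy hR hle hr ?_
        rw [dist_comm] at hj'
        linarith [dist_triangle x z (X j)]
      · have hj' := Metric.mem_closedBall.1 (Finset.mem_filter.1 hj).2
        rw [dist_comm] at hj'
        exact Finset.mem_filter.2 ⟨Finset.mem_univ j, by linarith⟩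
    have h2 := hnear.trans (hsingle z K i (by linarith [dist_triangle_left z (X i) x]))
    have h3 := mul_le_mul_of_nonneg_right h2 hb
    have h4 := mul_nonneg hb (hsum0 z K)
    linarith
  -- Far from the sample: with `r = 2^-(m+1)` the nearest distance is in `(2r, 4r]`. A ball of
  -- radius `r` around a centre within `r` of `x` misses the sample, and the nearest point is within
  -- `5r` of the centre.
  · obtain ⟨m, hmK, hlt, hle2⟩ := exists_dyadic_scale (hdiam x (X i)) (not_le.1 hfine)
    obtain ⟨z, hz, hxz⟩ := hT (m + 1) x
    have hr0 : (0 : ℝ) < (1 / 2) ^ (m + 1) := by positivity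
    have hr : (1 / 2 : ℝ) ^ m = 2 * (1 / 2) ^ (m + 1) := by rw [pow_succ]; ring
    rw [hr] at hlt hle2
    refine ⟨m + 1, Finset.mem_range.2 (by omega), z, hz, hxz, ?_⟩
    have hempty : (Finset.univ.filter fun i =>
        X i ∈ Metric.closedBall z ((1 / 2) ^ (m + 1))) = ∅ := by
      refine Finset.filter_eq_empty_iff.2 fun j _ hj => ?_
      have hj' := Metric.mem_closedBall.1 hj
      rw [dist_comm] at hj'
      linarith [dist_triangle x z (X j), hi j (Finset.mem_univ j)]
    rw [hempty, Finset.card_empty, Nat.cast_zero, mul_zero, zero_add]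
    have h2 := hnear.trans (hsingle z (m + 1) i (by linarith [dist_triangle_left z (X i) x]))
    have h3 := mul_le_mul_of_nonneg_right h2 hb
    have h4 := mul_nonneg hb (hsum0 z (m + 1))
    have h5 := hsum0 z (m + 1)
    linarith

variable [MeasurableSpace Ω] [BorelSpace Ω] (μ : Measure Ω) [IsProbabilityMeasure μ]

-- The slope of the extension is dominated by a sum of constants on net balls, which is then
-- integrated ball by ball.
open Classical in
lemma strongSlope_pmse_le (hn : 1 ≤ n) (hdiam : ∀ x x' : Ω, dist x x' ≤ 1)
    (hy : ∀ i, y (X i) = 0 ∨ y (X i) = 1)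
    (hle : ∀ i, localSlope y (X i) (range X) ≤ ENNReal.ofReal ((n : ℝ) ^ 2))
    {K : ℕ} (hK : n ^ 2 ≤ 2 ^ K) {T : ℕ → Finset Ω}
    (hT : ∀ k x, ∃ z ∈ T k, dist x z ≤ (1 / 2) ^ k) {M : ℕ}
    (hM : ∀ k p, ((T k).filter fun z => dist z p ≤ 8 * (1 / 2) ^ k).card ≤ M) {b : ℝ} (hb : 0 < b)
    (hμ : ∀ k ∈ Finset.range (K + 2), ∀ z ∈ T k, n * μ.real (Metric.closedBall z ((1 / 2) ^ k))
      ≤ 2 * (Finset.univ.filter fun i => X i ∈ Metric.closedBall z ((1 / 2) ^ k)).card + b) :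
    strongSlope (pmse y (range X)) μ univ
      ≤ ENNReal.ofReal ((K + 2) * (8 + 4 * b) * M)
        * strongSlope y (empiricalMeasure X) (range X) := by
  have hn0 : (0 : ℝ) < n := by exact_mod_cast hn
  have : NeZero n := ⟨by omega⟩
  have hfin : ∀ i, localSlope y (X i) (range X) ≠ ⊤ := fun i =>
    ((hle i).trans_lt ENNReal.ofReal_lt_top).ne
  set Λ : Fin n → ℝ := fun i => (localSlope y (X i) (range X)).toReal with hΛ
  have hΛ0 : ∀ i, 0 ≤ Λ i := fun i => ENNReal.toReal_nonneg
  set N : ℕ → Ω → ℝ := fun k z =>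
    2 * (Finset.univ.filter fun i => X i ∈ Metric.closedBall z ((1 / 2) ^ k)).card + b with hN
  have hN0 : ∀ k z, 0 < N k z := fun k z => by positivity
  set A : ℕ → Ω → ℝ := fun k z => ∑ i with dist z (X i) ≤ 8 * (1 / 2 : ℝ) ^ k, Λ i with hA
  have hA0 : ∀ k z, 0 ≤ A k z := fun k z => Finset.sum_nonneg fun i _ => hΛ0 i
  -- The denominator `N k z` also bounds `n μ(B)`, so it cancels when the ball is integrated.
  set W : ℕ → Ω → ℝ := fun k z => (8 + 4 * b) * A k z / N k z with hW
  have hW0 : ∀ k z, 0 ≤ W k z := fun k z =>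
    div_nonneg (mul_nonneg (by linarith) (hA0 k z)) (hN0 k z).le
  have hpt : ∀ x, localSlope (pmse y (range X)) x univ ≤ ∑ k ∈ Finset.range (K + 2), ∑ z ∈ T k,
      (Metric.closedBall z ((1 / 2) ^ k)).indicator (fun _ => ENNReal.ofReal (W k z)) x := by
    intro x
    obtain ⟨u, v, h⟩ := exists_isMaxPair y (finite_range X) (range_nonempty X) x
    obtain ⟨k, hk, z, hz, hxz, hbd⟩ := exists_net_ball hn hdiam hy hle hK hT hb.le h
    calc localSlope (pmse y (range X)) x univ
        ≤ ENNReal.ofReal (pairSlope y x u v) := localSlope_pmse_le (finite_range X) h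
      _ ≤ ENNReal.ofReal (W k z) :=
          ENNReal.ofReal_le_ofReal ((le_div_iff₀ (hN0 k z)).2 hbd)
      _ = (Metric.closedBall z ((1 / 2) ^ k)).indicator
            (fun _ => ENNReal.ofReal (W k z)) x := by
          rw [indicator_of_mem (Metric.mem_closedBall.2 hxz)]
      _ ≤ ∑ z ∈ T k, (Metric.closedBall z ((1 / 2) ^ k)).indicator
            (fun _ => ENNReal.ofReal (W k z)) x :=
          Finset.single_le_sum (f := fun z => (Metric.closedBall z ((1 / 2) ^ k)).indicator
            (fun _ => ENNReal.ofReal (W k z)) x) (fun _ _ => zero_le) hz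
      _ ≤ _ := Finset.single_le_sum (f := fun k => ∑ z ∈ T k,
            (Metric.closedBall z ((1 / 2) ^ k)).indicator
            (fun _ => ENNReal.ofReal (W k z)) x) (fun _ _ => zero_le) hk
  have hcell : ∀ k ∈ Finset.range (K + 2), ∀ z ∈ T k,
      W k z * μ.real (Metric.closedBall z ((1 / 2) ^ k)) ≤ (8 + 4 * b) * A k z / n := by
    intro k hk z hz
    rw [le_div_iff₀ hn0, hW, div_mul_eq_mul_div, div_mul_eq_mul_div, div_le_iff₀ (hN0 k z),
      mul_assoc]
    refine mul_le_mul_of_nonneg_left ?_ (mul_nonneg (by linarith) (hA0 k z))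
    rw [mul_comm]; exact hμ k hk z hz
  -- Exchange the sums: at each scale a sample point lies in at most `M` enlarged balls.
  have hdouble : ∀ k, ∑ z ∈ T k, A k z ≤ M * ∑ i, Λ i := by
    intro k
    simp only [hA, Finset.sum_filter]
    rw [Finset.sum_comm, Finset.mul_sum]
    refine Finset.sum_le_sum fun i _ => ?_
    rw [← Finset.sum_filter, Finset.sum_const, nsmul_eq_mul]
    exact mul_le_mul_of_nonneg_right (by exact_mod_cast hM k (X i)) (hΛ0 i)
  have hreal : ∑ k ∈ Finset.range (K + 2), ∑ z ∈ T k,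
      W k z * μ.real (Metric.closedBall z ((1 / 2) ^ k))
      ≤ (K + 2) * (8 + 4 * b) * M * ((n : ℝ)⁻¹ * ∑ i, Λ i) := by
    calc _ ≤ ∑ k ∈ Finset.range (K + 2), (8 + 4 * b) * (M * ∑ i, Λ i) / n := by
          refine Finset.sum_le_sum fun k hk => (Finset.sum_le_sum (hcell k hk)).trans ?_
          rw [← Finset.sum_div, ← Finset.mul_sum]
          gcongr
          exact hdouble k
      _ = _ := by
          rw [Finset.sum_const, Finset.card_range, nsmul_eq_mul]
          push_cast; field_simp
  have hemp : strongSlope y (empiricalMeasure X) (range X)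
      = ENNReal.ofReal ((n : ℝ)⁻¹ * ∑ i, Λ i) := by
    rw [strongSlope_empiricalMeasure, ENNReal.ofReal_mul (by positivity),
      ENNReal.ofReal_inv_of_pos hn0, ENNReal.ofReal_natCast,
      ENNReal.ofReal_sum_of_nonneg fun i _ => hΛ0 i]
    congr 1
    exact Finset.sum_congr rfl fun i _ => (ENNReal.ofReal_toReal (hfin i)).symm
  rw [hemp, ← ENNReal.ofReal_mul (by positivity)]
  calc strongSlope (pmse y (range X)) μ univ
      ≤ ∫⁻ x, ∑ k ∈ Finset.range (K + 2), ∑ z ∈ T k,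
          (Metric.closedBall z ((1 / 2) ^ k)).indicator (fun _ => ENNReal.ofReal (W k z)) x ∂μ := by
        rw [strongSlope, Measure.restrict_univ]
        exact lintegral_mono hpt
    _ = ∑ k ∈ Finset.range (K + 2), ∑ z ∈ T k,
          ENNReal.ofReal (W k z * μ.real (Metric.closedBall z ((1 / 2) ^ k))) := by
        rw [lintegral_finsetSum _ fun k _ => Finset.measurable_fun_sum _ fun z _ =>
          measurable_const.indicator Metric.isClosed_closedBall.measurableSet]
        refine Finset.sum_congr rfl fun k _ => ?_
        rw [lintegral_finsetSum _ fun z _ =>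
          measurable_const.indicator Metric.isClosed_closedBall.measurableSet]
        refine Finset.sum_congr rfl fun z _ => ?_
        rw [lintegral_indicator_const Metric.isClosed_closedBall.measurableSet,
          ENNReal.ofReal_mul (hW0 k z), ofReal_measureReal]
    _ = ENNReal.ofReal (∑ k ∈ Finset.range (K + 2), ∑ z ∈ T k,
          W k z * μ.real (Metric.closedBall z ((1 / 2) ^ k))) := by
        rw [ENNReal.ofReal_sum_of_nonneg fun k _ => Finset.sum_nonneg fun z _ =>
          mul_nonneg (hW0 k z) measureReal_nonneg]
        refine Finset.sum_congr rfl fun k _ => ?_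
        rw [ENNReal.ofReal_sum_of_nonneg fun z _ => mul_nonneg (hW0 k z) measureReal_nonneg]
    _ ≤ _ := ENNReal.ofReal_le_ofReal hreal

end Integration


/-! ### Absorbing numerical constants into powers of `D ≥ 2`. -/

section Constants

lemma log_bounds {n : ℕ} (hn : 2 ≤ n) :
    1 ≤ Nat.clog 2 n ∧ n ≤ 2 ^ Nat.clog 2 n ∧ (Nat.clog 2 n : ℝ) ≤ 3 * Real.log n ∧
      Real.log n ≤ Nat.clog 2 n := by
  have hn0 : (0 : ℝ) < n := by positivity
  have h1 : 1 ≤ Nat.clog 2 n := Nat.clog_pos one_lt_two hn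
  have h2 : n ≤ 2 ^ Nat.clog 2 n := Nat.le_pow_clog one_lt_two n
  have h3 : 2 ^ (Nat.clog 2 n - 1) < n := Nat.pow_pred_clog_lt_self one_lt_two hn
  have hl := Real.log_two_gt_d9
  have hl' := Real.log_two_lt_d9
  have hn2 : Real.log 2 ≤ Real.log n := Real.log_le_log two_pos (by exact_mod_cast hn)
  refine ⟨h1, h2, ?_, ?_⟩
  · have h4 : ((Nat.clog 2 n - 1 : ℕ) : ℝ) * Real.log 2 ≤ Real.log n := by
      rw [← Real.log_pow]
      exact Real.log_le_log (by positivity) (by exact_mod_cast h3.le)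
    rw [Nat.cast_sub h1, Nat.cast_one] at h4
    have h5 : (1 : ℝ) ≤ Nat.clog 2 n := by exact_mod_cast h1
    nlinarith
  · have h4 : Real.log n ≤ (Nat.clog 2 n : ℝ) * Real.log 2 := by
      rw [← Real.log_pow]
      exact Real.log_le_log hn0 (by exact_mod_cast h2)
    nlinarith

lemma net_constant_le {n D : ℕ} (hn : 2 ≤ n) (hD : 2 ≤ D) {K : ℕ} (hK : K = 2 * Nat.clog 2 n) :
    ((K : ℝ) + 2) * (8 + 4 * (2 * Real.log (((K + 2) * D ^ (K + 2)) * n))) * (D ^ 4 : ℕ)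
      ≤ (D : ℝ) ^ 16 * Real.log n ^ 2 := by
  obtain ⟨h1, -, h3, h4⟩ := log_bounds hn
  have hn0 : (0 : ℝ) < n := by positivity
  have hD0 : (0 : ℝ) < D := by positivity
  have hD2 : (2 : ℝ) ≤ D := by exact_mod_cast hD
  have h1' : (1 : ℝ) ≤ Nat.clog 2 n := by exact_mod_cast h1
  have hKr : (K : ℝ) = 2 * Nat.clog 2 n := by rw [hK]; push_cast; rfl
  set L : ℝ := (Nat.clog 2 n : ℝ)
  have hlog : Real.log (((K + 2) * D ^ (K + 2)) * n) ≤ 6 * (L * D) := by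
    rw [Real.log_mul (by positivity) hn0.ne', Real.log_mul (by positivity) (by positivity),
      Real.log_pow]
    have e1 := Real.log_le_sub_one_of_pos (show (0 : ℝ) < K + 2 by positivity)
    have e2 := Real.log_le_sub_one_of_pos hD0
    have e3 : ((K + 2 : ℕ) : ℝ) * Real.log D ≤ ((K + 2 : ℕ) : ℝ) * (D - 1) := by gcongr
    push_cast at e3 ⊢
    rw [hKr] at *
    nlinarith
  have hLD : 2 ≤ L * D := by nlinarith
  have h5 : 8 + 4 * (2 * Real.log (((K + 2) * D ^ (K + 2)) * n)) ≤ 52 * (L * D) := by linarith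
  have h6 : (K : ℝ) + 2 ≤ 4 * L := by linarith
  have h7 : L ^ 2 ≤ 9 * Real.log n ^ 2 := by nlinarith
  -- The accumulated constant is `4 · 52 · 9 = 1872 < 2 ^ 11`.
  have h8 : (2 : ℝ) ^ 11 ≤ (D : ℝ) ^ 11 := by gcongr
  push_cast
  calc ((K : ℝ) + 2) * (8 + 4 * (2 * Real.log (((K + 2) * D ^ (K + 2)) * n))) * (D : ℝ) ^ 4
      ≤ (4 * L) * (52 * (L * D)) * (D : ℝ) ^ 4 :=
        mul_le_mul_of_nonneg_right ((mul_le_mul_of_nonneg_left h5 (by positivity)).trans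
          (mul_le_mul_of_nonneg_right h6 (by positivity))) (by positivity)
    _ = 208 * L ^ 2 * (D : ℝ) ^ 5 := by ring
    _ ≤ 208 * (9 * Real.log n ^ 2) * (D : ℝ) ^ 5 := by gcongr
    _ = 1872 * (Real.log n ^ 2 * (D : ℝ) ^ 5) := by ring
    _ ≤ (D : ℝ) ^ 11 * (Real.log n ^ 2 * (D : ℝ) ^ 5) :=
        mul_le_mul_of_nonneg_right (by linarith) (by positivity)
    _ = _ := by ring

lemma log_cube_bounds {n D : ℕ} (hn : 2 ≤ n) (hD : 2 ≤ D) :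
    1 / (n : ℝ) ≤ (D : ℝ) ^ 2 * Real.log n ^ 3 / n ∧
      (D : ℝ) ^ 16 * Real.log n ^ 2 * (1 + Real.log n) ≤ (D : ℝ) ^ 18 * Real.log n ^ 3 := by
  have hl := Real.log_two_gt_d9
  have hD2 : (2 : ℝ) ≤ D := by exact_mod_cast hD
  have hn2 : Real.log 2 ≤ Real.log n := Real.log_le_log two_pos (by exact_mod_cast hn)
  have hsq : (4 : ℝ) ≤ (D : ℝ) ^ 2 := by nlinarith
  have hlog : (0.69 : ℝ) ≤ Real.log n := by linarith
  constructor
  · gcongr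
    calc (1 : ℝ) ≤ 4 * 0.69 ^ 3 := by norm_num
      _ ≤ _ := by gcongr
  · have h1 : 1 + Real.log n ≤ (D : ℝ) ^ 2 * Real.log n := by nlinarith
    calc (D : ℝ) ^ 16 * Real.log n ^ 2 * (1 + Real.log n)
        ≤ (D : ℝ) ^ 16 * Real.log n ^ 2 * ((D : ℝ) ^ 2 * Real.log n) := by gcongr
      _ = _ := by ring

end Constants

/-! ### The least doubling constant. -/

section Doubling

variable {Ω : Type*} [MetricSpace Ω]

lemma exists_doublingWith_ddim [Nonempty Ω] (h : IsDoubling Ω) :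
    ∃ D : ℕ, DoublingWith Ω D ∧ 1 ≤ D ∧ ∀ c : ℕ, (2 : ℝ) ^ ((c : ℝ) * ddim Ω) = (D : ℝ) ^ c := by
  have hD : DoublingWith Ω (sInf {D : ℕ | DoublingWith Ω D}) := Nat.sInf_mem h
  have h1 : 1 ≤ sInf {D : ℕ | DoublingWith Ω D} := by
    obtain ⟨s, hs, hcov⟩ := hD (Classical.arbitrary Ω) 1 one_pos
    obtain ⟨z, hz, -⟩ := mem_iUnion₂.1 (hcov (Metric.mem_closedBall_self zero_le_one))
    exact (Finset.card_pos.2 ⟨z, hz⟩).trans_le hs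
  refine ⟨_, hD, h1, fun c => ?_⟩
  rw [mul_comm, Real.rpow_mul two_pos.le, ddim,
    Real.rpow_logb two_pos (by norm_num) (by exact_mod_cast h1), Real.rpow_natCast]

/-- With `D = 1`, separated sets have at most one point at every scale. -/
lemma DoublingWith.subsingleton (h : DoublingWith Ω 1) (hdiam : ∀ x x' : Ω, dist x x' ≤ 1) :
    Subsingleton Ω := by
  classical
  refine ⟨fun a b => ?_⟩
  by_contra hne
  have hd : 0 < dist a b := dist_pos.2 hne
  obtain ⟨m, hm⟩ := exists_pow_lt_of_lt_one (show 0 < dist a b / 2 / 2 by positivity)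
    (show (1 / 2 : ℝ) < 1 by norm_num)
  have := h.card_le_of_separated (T := {a, b}) (r := dist a b / 2) (R := 1) (m := m) (p := a)
    one_pos (by rw [← one_div_pow]; exact hm.le) (by
      rw [Finset.coe_pair, pairwise_pair]
      exact fun _ => ⟨by linarith, by rw [dist_comm b a]; linarith⟩) (fun z _ => hdiam z a)
  rw [Finset.card_pair hne, one_pow] at this
  omega

end Doubling

/-! ### Constant labels. -/

section Constant

variable {Ω : Type*} [MetricSpace Ω] [MeasurableSpace Ω] {n : ℕ} {X : Fin n → Ω} {y : Ω → ℝ}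

lemma strongSlope_empiricalMeasure_of_const [BorelSpace Ω] (hy : ∀ i j, y (X i) = y (X j)) :
    strongSlope y (empiricalMeasure X) (range X) = 0 := by
  rw [strongSlope_empiricalMeasure, Finset.sum_eq_zero, mul_zero]
  intro i _
  refine le_antisymm (iSup₂_le ?_) zero_le
  rintro _ ⟨⟨j, rfl⟩, -⟩
  rw [hy i j]; simp

lemma strongSlope_pmse_of_const (hn : 1 ≤ n) (μ : Measure Ω) (hy : ∀ i j, y (X i) = y (X j)) :
    strongSlope (pmse y (range X)) μ univ = 0 := by
  have : NeZero n := ⟨by omega⟩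
  have h0 : ∀ x, localSlope (pmse y (range X)) x univ = 0 := fun x => by
    obtain ⟨u, v, h⟩ := exists_isMaxPair y (finite_range X) (range_nonempty X) x
    refine le_antisymm ((localSlope_pmse_le (finite_range X) h).trans ?_) zero_le
    obtain ⟨⟨i, rfl⟩, ⟨j, rfl⟩, -⟩ := h
    simp [pairSlope, hy j i]
  simp [strongSlope, h0]

end Constant

lemma slope_chain_of_const {Ω : Type*} [MetricSpace Ω] [MeasurableSpace Ω] [BorelSpace Ω]
    {n : ℕ} (hn : 1 ≤ n) {X : Fin n → Ω} {y : Ω → ℝ} (μ : Measure Ω)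
    (hy : ∀ i j, y (X i) = y (X j)) (a b : ℝ≥0∞) :
    weakSlope (pmse y (range X)) μ univ ≤ strongSlope (pmse y (range X)) μ univ ∧
      strongSlope (pmse y (range X)) μ univ
        ≤ a * strongSlope y (empiricalMeasure X) (range X) ∧
      a * strongSlope y (empiricalMeasure X) (range X)
        ≤ b * weakSlope y (empiricalMeasure X) (range X) := by
  have : NeZero n := ⟨by omega⟩
  refine ⟨weakSlope_le_strongSlope
    (continuous_pmse y (finite_range X) (range_nonempty X)) μ, ?_, ?_⟩
  · rw [strongSlope_pmse_of_const hn μ hy]; exact zero_le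
  · rw [strongSlope_empiricalMeasure_of_const hy, mul_zero]; exact zero_le

/-! ### Assembly. -/

open Classical in
lemma exists_event_slope_chain {Ω : Type*} [MetricSpace Ω] [MeasurableSpace Ω]
    [BorelSpace Ω] (μ : Measure Ω) [IsProbabilityMeasure μ] {D : ℕ} (hDW : DoublingWith Ω D)
    (hD1 : 1 ≤ D) (hdiam : ∀ x x' : Ω, dist x x' ≤ 1) {n : ℕ} (hn : 1 ≤ n) :
    ∃ E : Set (Fin n → Ω), MeasurableSet E ∧
      ENNReal.ofReal (1 - (D : ℝ) ^ 2 * Real.log n ^ 3 / n) ≤ Measure.pi (fun _ : Fin n => μ) E ∧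
      ∀ X ∈ E, ∀ y : Ω → ℝ, (∀ i, y (X i) = 0 ∨ y (X i) = 1) →
        weakSlope y (empiricalMeasure X) (range X) ≤ (n : ℝ≥0∞) →
        weakSlope (pmse y (range X)) μ univ ≤ strongSlope (pmse y (range X)) μ univ ∧
        strongSlope (pmse y (range X)) μ univ
          ≤ ENNReal.ofReal ((D : ℝ) ^ 16 * Real.log n ^ 2)
            * strongSlope y (empiricalMeasure X) (range X) ∧
        ENNReal.ofReal ((D : ℝ) ^ 16 * Real.log n ^ 2)
            * strongSlope y (empiricalMeasure X) (range X)
          ≤ ENNReal.ofReal ((D : ℝ) ^ 18 * Real.log n ^ 3)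
            * weakSlope y (empiricalMeasure X) (range X) := by
  have : NeZero n := ⟨by omega⟩
  -- If `n = 1`, then `log n = 0` and the event must have full measure; if `D = 1`, powers of `D`
  -- absorb nothing. In both cases the labels are constant on the sample.
  by_cases hdeg : n = 1 ∨ D = 1
  · refine ⟨univ, MeasurableSet.univ, ?_, fun X _ y _ _ => ?_⟩
    · rw [measure_univ]
      refine ENNReal.ofReal_le_one.2 (sub_le_self _ ?_)
      have := Real.log_natCast_nonneg n
      positivity
    · refine slope_chain_of_const hn μ (fun i j => ?_) _ _
      rcases hdeg with rfl | rfl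
      · rw [Subsingleton.elim i j]
      · have := hDW.subsingleton hdiam
        rw [Subsingleton.elim (X i) (X j)]
  push Not at hdeg
  have hn2 : 2 ≤ n := by omega
  have hD2 : 2 ≤ D := by omega
  choose T hTcard hTcov hTnear using hDW.exists_net hdiam
  set K := 2 * Nat.clog 2 n with hK
  have hcard : ((((Finset.range (K + 2)).sigma T).card : ℕ) : ℝ) ≤ (K + 2) * (D : ℝ) ^ (K + 2) := by
    rw [Finset.card_sigma]
    have : ∑ k ∈ Finset.range (K + 2), (T k).card ≤ ∑ _k ∈ Finset.range (K + 2), D ^ (K + 2) :=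
      Finset.sum_le_sum fun k hk => (hTcard k).trans
        (Nat.pow_le_pow_right hD1 (Finset.mem_range.1 hk))
    rw [Finset.sum_const, Finset.card_range, smul_eq_mul] at this
    exact_mod_cast this
  have hN1 : (1 : ℝ) < ((K + 2) * (D : ℝ) ^ (K + 2)) * n := by
    have h1 : (1 : ℝ) ≤ (D : ℝ) ^ (K + 2) := one_le_pow₀ (by exact_mod_cast hD1)
    have h2 : (2 : ℝ) ≤ n := by exact_mod_cast hn2
    have h3 : (0 : ℝ) ≤ K := Nat.cast_nonneg K
    nlinarith [mul_nonneg h3 (zero_le_one.trans h1)]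
  obtain ⟨E, hE, hEμ, hEX⟩ := exists_uniform_event μ ((Finset.range (K + 2)).sigma T)
    (fun c => Metric.closedBall c.2 ((1 / 2) ^ c.1))
    (fun c _ => Metric.isClosed_closedBall.measurableSet) hn (by positivity) hcard
  refine ⟨E, hE, ?_, fun X hX y hy hw => ⟨?_, ?_, ?_⟩⟩
  · refine le_trans (ENNReal.ofReal_le_ofReal ?_) hEμ
    linarith [(log_cube_bounds hn2 hD2).1]
  · exact weakSlope_le_strongSlope (continuous_pmse y (finite_range X) (range_nonempty X)) μ
  · refine (strongSlope_pmse_le μ hn hdiam hy (localSlope_le_sq hn hw) (K := K) ?_ hTcov hTnear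
      (b := 2 * Real.log (((K + 2) * (D : ℝ) ^ (K + 2)) * n))
      (mul_pos two_pos (Real.log_pos hN1)) fun k hk z hz => ?_).trans ?_
    · rw [hK, mul_comm 2, pow_mul]
      exact Nat.pow_le_pow_left (log_bounds hn2).2.1 2
    · exact hEX X hX ⟨k, z⟩ (Finset.mem_sigma.2 ⟨hk, hz⟩)
    · exact mul_le_mul_left (ENNReal.ofReal_le_ofReal (net_constant_le hn2 hD2 hK)) _
  · refine (mul_le_mul_right (strongSlope_le_weakSlope hn hw) _).trans ?_
    rw [← mul_assoc, ← ENNReal.ofReal_mul (by positivity)]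
    exact mul_le_mul_left (ENNReal.ofReal_le_ofReal (log_cube_bounds hn2 hD2).2) _

end AvgSlope

theorem lemma7p1 :
    ∃ (P : AvgSlope.Prog) (C : ℕ) (c₁ c₂ c₃ : ℝ),
      ∀ (Ω : Type*) [MetricSpace Ω] [MeasurableSpace Ω] [BorelSpace Ω]
        (μ : Measure Ω) [IsProbabilityMeasure μ],
        AvgSlope.IsDoubling Ω → (∀ x x' : Ω, dist x x' ≤ 1) →
        ∀ n : ℕ, 1 ≤ n →
          -- the extension is well defined, `[0,1]`-valued, agrees with the labels on the sample,
          -- and is computed at any given point in `O(n²)` steps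
          (∀ (X : Fin n → Ω) (y : Ω → ℝ),
            (∀ i, y (X i) = 0 ∨ y (X i) = 1) →
            AvgSlope.weakSlope y (AvgSlope.empiricalMeasure X) (Set.range X) ≤ (n : ℝ≥0∞) →
            AvgSlope.IsPMSE y (Set.range X) (AvgSlope.pmse y (Set.range X)) ∧
            (∀ x, AvgSlope.pmse y (Set.range X) x ∈ Set.Icc (0 : ℝ) 1) ∧
            (∀ i, AvgSlope.pmse y (Set.range X) (X i) = y (X i)) ∧
            ∀ x : Ω,
              P.output (AvgSlope.inputStore (fun i => dist x (X i)) (fun i => y (X i)))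
                = AvgSlope.pmse y (Set.range X) x ∧
              P.time (AvgSlope.inputStore (fun i => dist x (X i)) (fun i => y (X i)))
                ≤ C * n ^ 2) ∧
          -- with high probability over the sample, simultaneously for all labellings
          ∃ E : Set (Fin n → Ω), MeasurableSet E ∧
            ENNReal.ofReal (1 - (2 : ℝ) ^ (c₃ * AvgSlope.ddim Ω) * Real.log n ^ 3 / n)
              ≤ Measure.pi (fun _ : Fin n => μ) E ∧
            ∀ X ∈ E, ∀ y : Ω → ℝ,
              (∀ i, y (X i) = 0 ∨ y (X i) = 1) →
              AvgSlope.weakSlope y (AvgSlope.empiricalMeasure X) (Set.range X) ≤ (n : ℝ≥0∞) →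
              AvgSlope.weakSlope (AvgSlope.pmse y (Set.range X)) μ Set.univ
                ≤ AvgSlope.strongSlope (AvgSlope.pmse y (Set.range X)) μ Set.univ ∧
              AvgSlope.strongSlope (AvgSlope.pmse y (Set.range X)) μ Set.univ
                ≤ ENNReal.ofReal ((2 : ℝ) ^ (c₁ * AvgSlope.ddim Ω) * Real.log n ^ 2)
                  * AvgSlope.strongSlope y (AvgSlope.empiricalMeasure X) (Set.range X) ∧
              ENNReal.ofReal ((2 : ℝ) ^ (c₁ * AvgSlope.ddim Ω) * Real.log n ^ 2)
                  * AvgSlope.strongSlope y (AvgSlope.empiricalMeasure X) (Set.range X)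
                ≤ ENNReal.ofReal ((2 : ℝ) ^ (c₂ * AvgSlope.ddim Ω) * Real.log n ^ 3)
                  * AvgSlope.weakSlope y (AvgSlope.empiricalMeasure X) (Set.range X) := by
  refine ⟨AvgSlope.pmseProg, 12, (16 : ℕ), (18 : ℕ), (2 : ℕ), ?_⟩
  intro Ω _ _ _ μ _ hdoubling hdiam n hn
  have : NeZero n := ⟨by omega⟩
  have : Nonempty Ω := nonempty_of_isProbabilityMeasure μ
  obtain ⟨D, hDW, hD1, hpow⟩ := AvgSlope.exists_doublingWith_ddim hdoubling
  refine ⟨fun X y hy _ => ?_, ?_⟩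
  · have hfin := Set.finite_range X
    refine ⟨AvgSlope.isPMSE_pmse y hfin (Set.range_nonempty X),
      AvgSlope.pmse_mem_Icc hfin (Set.range_nonempty X) ?_,
      fun i => AvgSlope.pmse_eq_of_mem y hfin (Set.mem_range_self i),
      AvgSlope.pmseProg_correct hn X y⟩
    rintro _ ⟨i, rfl⟩
    rcases hy i with h | h <;> rw [h] <;> norm_num
  · simp only [hpow]
    exact AvgSlope.exists_event_slope_chain μ hDW hD1 hdiam hn
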